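/- Graphs are simple and undirected; a graph map is a function on vertices that sends each edge to an edge or contracts it to a vertex, and colimits of graphs are taken in the category of graphs and graph maps. For $k\ge 3$ let $C_k$ be the $k$-cycle with vertex set $\mathbb{Z}/k$, and let $I_n$ be the path with vertices $0,\dots,n$ and $I_\infty$ the two-sided infinite path with vertex set $\mathbb{Z}$ (with $i\sim i+1$). For a graph $Y$, let $Y\,\square\, I_n$ be the box (Cartesian) product: $(y,i)\sim(y',i')$ iff ($y\sim y'$ and $i=i'$) or ($y=y'$ and $i\sim i'$). The cone $\mathsf{Cone}_n(Y)$ is obtained from $Y\,\square\, I_n$ by collapsing $Y\times\{0\}$ to one vertex, i.e. it is the pushout of $I_0\leftarrow Y\,\square\, I_0\to Y\,\square\, I_n$. The disk is $D_{k,n}=\mathsf{Cone}_n(C_k)$, with boundary $\partial_{k,n}\colon C_k\to D_{k,n}$, $i\mapsto (i,n)$. **Fundamental group.** Let $X$ be a graph with a vertex $x$. A loop at $x$ is a graph map $\gamma\colon I_\infty\to X$ with $\gamma(i)=x$ for all $i$ outside a finite set. Two distinct loops $\gamma,\sigma$ at $x$ are adjacent if, for each $i\in\mathbb{Z}$, $\gamma(i)$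 and $\sigma(i)$ are equal or adjacent in $X$; this defines a graph $\Omega_\infty(X,x)$. Then $A_1(X,x)$ is the set of connected components of $\Omega_\infty(X,x)$, a group under the operation induced by concatenation of loops: $\gamma*\sigma$ follows $\gamma$ up to a time after which $\gamma$ stays at $x$, and then follows $\sigma$ from a time before which $\sigma$ stays at $x$ (the class of the result does not depend on these times). **The graph of a presentation.** Let $m,n\ge 0$ and let $r_1,\dots,r_n$ be terms in the generators $s_1,\dots,s_m$, i.e. formal products $r=s_{i_1}^{d_1}\cdots s_{i_k}^{d_k}$ with $d_l\in\mathbb{Z}$ (not necessarily reduced), each of positive degree $\deg(r)=|d_1|+\dots+|d_k|$. Let $\bigvee_{i=1}^m C_5$ be the wedge of $m$ copies of $C_5$, joined at the vertices $0$ (a single vertex if $m=0$). For such a term $r$, let $\varepsilon_r\colon C_{5\deg(r)}\to\bigvee_{i=1}^m C_5$ be the graph map that starts at the wedge point and first wraps $|d_1|$ times around the copy of $C_5$ of index $i_1$, then $|d_2|$ times around the copy of index $i_2$, and so on, in the positive direction where $d_l>0$ and in the negative direction where $d_l<0$: if the vertex $t\in\{0,\dots,5\deg(r)-1\}$ belongs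 to a letter $s_i^{\pm1}$ when $r$ is written out letter by letter, each letter taking five steps, then $\varepsilon_r(t)$ is the vertex $\pm t \bmod 5$ of the copy of index $i$. Let $X_{\langle S\mid R\rangle}$ be the pushout of $$\coprod_{j=1}^n D_{5\deg(r_j),3}\;\xleftarrow{\ \coprod_j\partial_{5\deg(r_j),3}\ }\;\coprod_{j=1}^n C_{5\deg(r_j)}\;\xrightarrow{\ (\varepsilon_{r_j})_j\ }\;\bigvee_{i=1}^m C_5 .$$ **Theorem.** Let $G$ be a group with a finite presentation $G\cong\langle s_1,\dots,s_m\mid r_1,\dots,r_n\rangle$ in which every relator $r_j$ is a term of positive degree. Then $$A_1\bigl(X_{\langle S\mid R\rangle},x\bigr)\cong G$$ as groups, for every vertex $x$ of $X_{\langle S\mid R\rangle}$. -/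

import Mathlib

namespace DiscreteHomotopy

/-! ### Graphs and graph maps

Graphs are simple undirected graphs. A graph map may contract an edge to a vertex. -/

/-- A graph map: each edge is sent to an edge or contracted to a vertex. -/
@[ext]
structure GraphMap {V W : Type*} (X : SimpleGraph V) (Y : SimpleGraph W) where
  toFun : V → W
  map_adj : ∀ ⦃a b : V⦄, X.Adj a b → toFun a = toFun b ∨ Y.Adj (toFun a) (toFun b)

/-- The internal hom: distinct graph maps are adjacent when they are pointwise equal or adjacent. -/
def internalHom {V W : Type*} (X : SimpleGraph V) (Y : SimpleGraph W) :
    SimpleGraph (GraphMap X Y) where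
  Adj f g := f ≠ g ∧ ∀ v, f.toFun v = g.toFun v ∨ Y.Adj (f.toFun v) (g.toFun v)
  symm := ⟨fun _ _ h => ⟨h.1.symm, fun v => (h.2 v).imp Eq.symm (fun e => e.symm)⟩⟩
  loopless := ⟨fun _ h => h.1 rfl⟩

/-- The infinite interval `I_∞`: vertices the integers, edges `i ∼ i + 1`. -/
def infInterval : SimpleGraph ℤ where
  Adj i j := j = i + 1 ∨ i = j + 1
  symm := ⟨fun _ _ h => h.symm⟩
  loopless := ⟨fun i h => by rcases h with h | h <;> omega⟩

/-! ### Paths of infinite length and the fundamental group -/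

/-- A path of length `∞` from `x` to `x'`: a graph map `I_∞ → X` which is constantly `x` near `-∞`
and constantly `x'` near `+∞`. -/
@[ext]
structure InfPath {V : Type*} (X : SimpleGraph V) (x x' : V) extends GraphMap infInterval X where
  eventually_left : ∃ N : ℤ, ∀ i ≤ N, toFun i = x
  eventually_right : ∃ N : ℤ, ∀ i ≥ N, toFun i = x'

namespace InfPath

variable {V : Type*} {X : SimpleGraph V} {x x' x'' x''' : V}

/-- The `∞`-path graph `P_∞ X (x, x')`: the full subgraph of the internal hom from `I_∞` to `X`
on the paths of length `∞` from `x` to `x'`. -/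
def pathSpace (X : SimpleGraph V) (x x' : V) : SimpleGraph (InfPath X x x') :=
  (internalHom infInterval X).comap InfPath.toGraphMap

/-- The constant path. -/
def const (X : SimpleGraph V) (x : V) : InfPath X x x where
  toFun _ := x
  map_adj _ _ _ := Or.inl rfl
  eventually_left := ⟨0, fun _ _ => rfl⟩
  eventually_right := ⟨0, fun _ _ => rfl⟩

theorem step (γ : InfPath X x x') (i : ℤ) :
    γ.toFun i = γ.toFun (i + 1) ∨ X.Adj (γ.toFun i) (γ.toFun (i + 1)) :=
  γ.map_adj (Or.inl rfl)

/-- A path of length `∞` from its consecutive steps. -/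
def ofStep (f : ℤ → V) (hf : ∀ i, f i = f (i + 1) ∨ X.Adj (f i) (f (i + 1)))
    (hl : ∃ N : ℤ, ∀ i ≤ N, f i = x) (hr : ∃ N : ℤ, ∀ i ≥ N, f i = x') : InfPath X x x' where
  toFun := f
  map_adj := by
    rintro a b (rfl | rfl)
    · exact hf a
    · exact (hf b).imp Eq.symm (fun e => e.symm)
  eventually_left := hl
  eventually_right := hr

/-- The inverse path `i ↦ γ (-i)`. -/
def inverse (γ : InfPath X x x') : InfPath X x' x :=
  ofStep (fun i => γ.toFun (-i))
    (fun i => by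
      have h := γ.step (-(i + 1))
      have e : -(i + 1) + 1 = -i := by ring
      rw [e] at h
      exact h.imp Eq.symm (fun e => e.symm))
    (by
      obtain ⟨N, hN⟩ := γ.eventually_right
      exact ⟨-N, fun i hi => hN _ (by omega)⟩)
    (by
      obtain ⟨N, hN⟩ := γ.eventually_left
      exact ⟨-N, fun i hi => hN _ (by omega)⟩)

/-- Follow `γ` up to time `M`, then follow `σ` from time `N` on. -/
def concatAt (γ : InfPath X x x') (σ : InfPath X x' x'') (M N : ℤ)
    (hM : ∀ i ≥ M, γ.toFun i = x') (hN : ∀ i ≤ N, σ.toFun i = x') : InfPath X x x'' :=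
  ofStep (fun i => if i ≤ M then γ.toFun i else σ.toFun (i - M + N))
    (fun i => by
      rcases lt_trichotomy i M with h | h | h
      · rw [if_pos h.le, if_pos (by omega)]
        exact γ.step i
      · subst h
        have e0 : γ.toFun i = σ.toFun N := (hM i le_rfl).trans (hN N le_rfl).symm
        rw [if_pos le_rfl, if_neg (by omega), e0]
        have e : i + 1 - i + N = N + 1 := by ring
        rw [e]
        exact σ.step N
      · rw [if_neg (by omega), if_neg (by omega)]
        have e : i + 1 - M + N = i - M + N + 1 := by ring
        rw [e]
        exact σ.step _)
    (by
      obtain ⟨K, hK⟩ := γ.eventually_left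
      exact ⟨min K M, fun i hi => by rw [if_pos (by omega)]; exact hK _ (by omega)⟩)
    (by
      obtain ⟨K, hK⟩ := σ.eventually_right
      exact ⟨max (M + 1) (K + M - N), fun i hi => by
        rw [if_neg (by omega)]; exact hK _ (by omega)⟩)

/-- The smallest `M` with `γ i = x'` for all `i ≥ M`. For the constant path there is no smallest
such integer, every integer qualifies, and the value is `0`. -/
noncomputable def endTime (γ : InfPath X x x') : ℤ := sInf {M : ℤ | ∀ i ≥ M, γ.toFun i = x'}

/-- The largest `N` with `γ i = x` for all `i ≤ N`. For the constant path there is no largest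
such integer, every integer qualifies, and the value is `0`. -/
noncomputable def startTime (γ : InfPath X x x') : ℤ := sSup {N : ℤ | ∀ i ≤ N, γ.toFun i = x}

theorem endTime_spec (γ : InfPath X x x') : ∀ i ≥ γ.endTime, γ.toFun i = x' := by
  by_cases hb : BddBelow {M : ℤ | ∀ i ≥ M, γ.toFun i = x'}
  · exact Int.csInf_mem γ.eventually_right hb
  · intro i hi
    have h0 : γ.endTime = 0 := Int.csInf_of_not_bddBelow hb
    rw [not_bddBelow_iff] at hb
    obtain ⟨M, hM, hM0⟩ := hb 0
    exact hM i (by omega)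

theorem startTime_spec (γ : InfPath X x x') : ∀ i ≤ γ.startTime, γ.toFun i = x := by
  by_cases hb : BddAbove {N : ℤ | ∀ i ≤ N, γ.toFun i = x}
  · exact Int.csSup_mem γ.eventually_left hb
  · intro i hi
    have h0 : γ.startTime = 0 := Int.csSup_of_not_bddAbove hb
    rw [not_bddAbove_iff] at hb
    obtain ⟨N, hN, hN0⟩ := hb 0
    exact hN i (by omega)

/-- The concatenation `γ ∗ σ`. -/
noncomputable def concat (γ : InfPath X x x') (σ : InfPath X x' x'') : InfPath X x x'' :=
  concatAt γ σ γ.endTime σ.startTime γ.endTime_spec σ.startTime_spec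

/-! Path-homotopy, that is, connectedness in the path graph, is compatible with concatenation. -/

theorem ext_fun {γ σ : InfPath X x x'} (h : ∀ i, γ.toFun i = σ.toFun i) : γ = σ :=
  InfPath.ext (funext h)

theorem reachable_of_forall {γ σ : InfPath X x x'}
    (h : ∀ i, γ.toFun i = σ.toFun i ∨ X.Adj (γ.toFun i) (σ.toFun i)) :
    (pathSpace X x x').Reachable γ σ := by
  by_cases e : γ = σ
  · rw [e]
  · refine SimpleGraph.Adj.reachable ⟨fun e' => e ?_, h⟩
    exact ext_fun fun i => congrFun (congrArg GraphMap.toFun e') i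

theorem concatAt_succ_left (γ : InfPath X x x') (σ : InfPath X x' x'') (M N : ℤ)
    (hM : ∀ i ≥ M, γ.toFun i = x') (hN : ∀ i ≤ N, σ.toFun i = x')
    (hM' : ∀ i ≥ M + 1, γ.toFun i = x') :
    (pathSpace X x x'').Reachable (concatAt γ σ (M + 1) N hM' hN) (concatAt γ σ M N hM hN) := by
  apply reachable_of_forall
  intro i
  have key : (concatAt γ σ (M + 1) N hM' hN).toFun i
      = (concatAt γ σ M N hM hN).toFun (if i ≤ M then i else i - 1) := by
    simp only [concatAt, ofStep]
    rcases lt_trichotomy i (M + 1) with h | h | h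
    · rw [if_pos (by omega), if_pos (by omega : i ≤ M), if_pos (by omega)]
    · subst h
      rw [if_pos le_rfl, if_neg (by omega : ¬ M + 1 ≤ M), if_pos (by omega), hM' _ le_rfl,
        hM _ (by omega)]
    · rw [if_neg (by omega), if_neg (by omega : ¬ i ≤ M), if_neg (by omega)]
      congr 1; ring
  rw [key]
  split_ifs
  · exact Or.inl rfl
  · have h := (concatAt γ σ M N hM hN).step (i - 1)
    rwa [sub_add_cancel] at h

theorem concatAt_pred_right (γ : InfPath X x x') (σ : InfPath X x' x'') (M N : ℤ)
    (hM : ∀ i ≥ M, γ.toFun i = x') (hN : ∀ i ≤ N, σ.toFun i = x')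
    (hM' : ∀ i ≥ M + 1, γ.toFun i = x') (hN' : ∀ i ≤ N - 1, σ.toFun i = x') :
    concatAt γ σ M (N - 1) hM hN' = concatAt γ σ (M + 1) N hM' hN := by
  apply ext_fun
  intro i
  simp only [concatAt, ofStep]
  rcases lt_trichotomy i (M + 1) with h | h | h
  · rw [if_pos (by omega), if_pos (by omega)]
  · subst h
    rw [if_neg (by omega), if_pos le_rfl, hM' _ le_rfl, hN _ (by omega)]
  · rw [if_neg (by omega), if_neg (by omega)]
    congr 1; ring

theorem concatAt_add_left (γ : InfPath X x x') (σ : InfPath X x' x'') (M N : ℤ) (k : ℕ)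
    (hM : ∀ i ≥ M, γ.toFun i = x') (hN : ∀ i ≤ N, σ.toFun i = x')
    (hM' : ∀ i ≥ M + k, γ.toFun i = x') :
    (pathSpace X x x'').Reachable (concatAt γ σ (M + k) N hM' hN) (concatAt γ σ M N hM hN) := by
  induction k with
  | zero => simp only [Nat.cast_zero, add_zero]; exact SimpleGraph.Reachable.refl _
  | succ k ih =>
    have h1 : ∀ i ≥ M + k, γ.toFun i = x' := fun i hi => hM i (by omega)
    refine SimpleGraph.Reachable.trans ?_ (ih h1)
    have := concatAt_succ_left γ σ (M + k) N h1 hN (fun i hi => hM i (by omega))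
    simpa only [Nat.cast_succ, add_assoc] using this

theorem concatAt_sub_right (γ : InfPath X x x') (σ : InfPath X x' x'') (M N : ℤ) (k : ℕ)
    (hM : ∀ i ≥ M, γ.toFun i = x') (hN : ∀ i ≤ N, σ.toFun i = x')
    (hN' : ∀ i ≤ N - k, σ.toFun i = x') :
    (pathSpace X x x'').Reachable (concatAt γ σ M (N - k) hM hN') (concatAt γ σ M N hM hN) := by
  induction k with
  | zero => simp only [Nat.cast_zero, sub_zero]; exact SimpleGraph.Reachable.refl _
  | succ k ih =>
    have h1 : ∀ i ≤ N - k, σ.toFun i = x' := fun i hi => hN i (by omega)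
    refine SimpleGraph.Reachable.trans ?_ (ih h1)
    have e := concatAt_pred_right γ σ M (N - k) hM h1 (fun i hi => hM i (by omega))
      (fun i hi => hN i (by omega))
    have r := concatAt_succ_left γ σ M (N - k) hM h1 (fun i hi => hM i (by omega))
    rw [← e] at r
    simpa only [Nat.cast_succ, sub_sub] using r

/-- Up to path-homotopy, concatenation does not depend on the cutting times. -/
theorem concatAt_reachable (γ : InfPath X x x') (σ : InfPath X x' x'') (M N M' N' : ℤ)
    (hM : ∀ i ≥ M, γ.toFun i = x') (hN : ∀ i ≤ N, σ.toFun i = x')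
    (hM' : ∀ i ≥ M', γ.toFun i = x') (hN' : ∀ i ≤ N', σ.toFun i = x') :
    (pathSpace X x x'').Reachable (concatAt γ σ M N hM hN) (concatAt γ σ M' N' hM' hN') := by
  have main : ∀ (M N M' N' : ℤ) (hM : ∀ i ≥ M, γ.toFun i = x') (hN : ∀ i ≤ N, σ.toFun i = x')
      (hM' : ∀ i ≥ M', γ.toFun i = x') (hN' : ∀ i ≤ N', σ.toFun i = x'), M ≤ M' → N' ≤ N →
      (pathSpace X x x'').Reachable (concatAt γ σ M' N' hM' hN') (concatAt γ σ M N hM hN) := by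
    intro M N M' N' hM hN hM' hN' h1 h2
    obtain ⟨k, rfl⟩ := Int.le.dest h1
    obtain ⟨l, hl⟩ := Int.le.dest h2
    obtain rfl : N' = N - l := by omega
    exact (concatAt_add_left γ σ M (N - l) k hM hN' hM').trans
      (concatAt_sub_right γ σ M N l hM hN hN')
  have hM2 : ∀ i ≥ max M M', γ.toFun i = x' := fun i hi => hM i (by omega)
  have hN2 : ∀ i ≤ min N N', σ.toFun i = x' := fun i hi => hN i (by omega)
  exact (main M N _ _ hM hN hM2 hN2 (le_max_left _ _) (min_le_left _ _)).symm.trans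
    (main M' N' _ _ hM' hN' hM2 hN2 (le_max_right _ _) (min_le_right _ _))

theorem concat_reachable_of_adj {γ γ' : InfPath X x x'} {σ σ' : InfPath X x' x''}
    (hγ : ∀ i, γ.toFun i = γ'.toFun i ∨ X.Adj (γ.toFun i) (γ'.toFun i))
    (hσ : ∀ i, σ.toFun i = σ'.toFun i ∨ X.Adj (σ.toFun i) (σ'.toFun i)) :
    (pathSpace X x x'').Reachable (concat γ σ) (concat γ' σ') := by
  have a1 : ∀ i ≥ max γ.endTime γ'.endTime, γ.toFun i = x' :=
    fun i hi => γ.endTime_spec i (by omega)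
  have a2 : ∀ i ≥ max γ.endTime γ'.endTime, γ'.toFun i = x' :=
    fun i hi => γ'.endTime_spec i (by omega)
  have b1 : ∀ i ≤ min σ.startTime σ'.startTime, σ.toFun i = x' :=
    fun i hi => σ.startTime_spec i (by omega)
  have b2 : ∀ i ≤ min σ.startTime σ'.startTime, σ'.toFun i = x' :=
    fun i hi => σ'.startTime_spec i (by omega)
  refine (concatAt_reachable γ σ _ _ _ _ _ _ a1 b1).trans (SimpleGraph.Reachable.trans ?_
    (concatAt_reachable γ' σ' _ _ _ _ a2 b2 _ _))
  apply reachable_of_forall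
  intro i
  simp only [concatAt, ofStep]
  split_ifs
  · exact hγ _
  · exact hσ _

theorem concat_reachable {γ γ' : InfPath X x x'} {σ σ' : InfPath X x' x''}
    (hγ : (pathSpace X x x').Reachable γ γ') (hσ : (pathSpace X x' x'').Reachable σ σ') :
    (pathSpace X x x'').Reachable (concat γ σ) (concat γ' σ') := by
  have h1 : ∀ {γ γ' : InfPath X x x'}, (pathSpace X x x').Reachable γ γ' →
      (pathSpace X x x'').Reachable (concat γ σ) (concat γ' σ) := by
    rintro γ γ' ⟨p⟩
    induction p with
    | nil => exact SimpleGraph.Reachable.refl _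
    | cons h _ ih =>
      exact (concat_reachable_of_adj h.2 (fun _ => Or.inl rfl)).trans ih
  have h2 : ∀ {σ σ' : InfPath X x' x''}, (pathSpace X x' x'').Reachable σ σ' →
      (pathSpace X x x'').Reachable (concat γ' σ) (concat γ' σ') := by
    rintro σ σ' ⟨p⟩
    induction p with
    | nil => exact SimpleGraph.Reachable.refl _
    | cons h _ ih =>
      exact (concat_reachable_of_adj (fun _ => Or.inl rfl) h.2).trans ih
  exact (h1 hγ).trans (h2 hσ)

theorem inverse_reachable {γ γ' : InfPath X x x'} (h : (pathSpace X x x').Reachable γ γ') :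
    (pathSpace X x' x).Reachable γ.inverse γ'.inverse := by
  obtain ⟨p⟩ := h
  induction p with
  | nil => exact SimpleGraph.Reachable.refl _
  | cons h _ ih => exact (reachable_of_forall fun i => h.2 (-i)).trans ih

theorem concat_assoc (γ : InfPath X x x') (σ : InfPath X x' x'') (τ : InfPath X x'' x''') :
    (pathSpace X x x''').Reachable (concat (concat γ σ) τ) (concat γ (concat σ τ)) := by
  set M := γ.endTime with hMdef
  set N := min σ.startTime σ.endTime
  set P := σ.endTime with hPdef
  set Q := τ.startTime with hQdef
  have hM : ∀ i ≥ M, γ.toFun i = x' := γ.endTime_spec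
  have hN : ∀ i ≤ N, σ.toFun i = x' := fun i hi => σ.startTime_spec i (by omega)
  have hP : ∀ i ≥ P, σ.toFun i = x'' := σ.endTime_spec
  have hQ : ∀ i ≤ Q, τ.toFun i = x'' := τ.startTime_spec
  have hNP : N ≤ P := min_le_right _ _
  have hL : ∀ i ≥ M - N + P, (concatAt γ σ M N hM hN).toFun i = x'' := by
    intro i hi
    simp only [concatAt, ofStep]
    split_ifs with h
    · have e1 : N = P := by omega
      have e2 : i = M := by omega
      rw [e2, hM M le_rfl, ← hN N le_rfl, e1, hP P le_rfl]
    · exact hP _ (by omega)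
  have hR : ∀ i ≤ N, (concatAt σ τ P Q hP hQ).toFun i = x' := by
    intro i hi
    simp only [concatAt, ofStep]
    rw [if_pos (by omega)]
    exact hN i hi
  have e : concatAt (concatAt γ σ M N hM hN) τ (M - N + P) Q hL hQ
      = concatAt γ (concatAt σ τ P Q hP hQ) M N hM hR := by
    apply ext_fun
    intro i
    simp only [concatAt, ofStep]
    by_cases h1 : i ≤ M
    · rw [if_pos (by omega), if_pos h1, if_pos h1]
    · rw [if_neg h1, if_neg h1]
      by_cases h2 : i ≤ M - N + P
      · rw [if_pos h2, if_pos (by omega)]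
      · rw [if_neg h2, if_neg (by omega)]
        congr 1; ring
  have s1 : (pathSpace X x x'').Reachable (concat γ σ) (concatAt γ σ M N hM hN) :=
    concatAt_reachable ..
  have s2 : (pathSpace X x' x''').Reachable (concat σ τ) (concatAt σ τ P Q hP hQ) :=
    concatAt_reachable ..
  refine (concat_reachable s1 (SimpleGraph.Reachable.refl τ)).trans (SimpleGraph.Reachable.trans ?_
    (concat_reachable (SimpleGraph.Reachable.refl γ) s2).symm)
  refine (concatAt_reachable _ _ _ _ _ _ _ _ hL hQ).trans ?_
  rw [e]
  exact concatAt_reachable ..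

theorem const_concat (γ : InfPath X x x') :
    (pathSpace X x x').Reachable (concat (const X x) γ) γ := by
  have e : concatAt (const X x) γ γ.startTime γ.startTime (fun _ _ => rfl) γ.startTime_spec
      = γ := by
    apply ext_fun
    intro i
    simp only [concatAt, ofStep]
    split_ifs with h
    · exact (γ.startTime_spec i h).symm
    · congr 1; ring
  have r := concatAt_reachable (const X x) γ (const X x).endTime γ.startTime γ.startTime
    γ.startTime (const X x).endTime_spec γ.startTime_spec (fun _ _ => rfl) γ.startTime_spec
  rw [e] at r
  exact r

theorem concat_inverse (γ : InfPath X x x') :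
    (pathSpace X x x).Reachable (concat γ γ.inverse) (const X x) := by
  obtain ⟨N, hN⟩ := γ.eventually_left
  obtain ⟨M, hM⟩ := γ.eventually_right
  have fold : ∀ k : ℕ, ∀ K : ℤ, ∃ δ : InfPath X x x,
      (∀ i, δ.toFun i = γ.toFun (min i (min (2 * K - i) (N + k)))) ∧
      (pathSpace X x x).Reachable δ (const X x) := by
    intro k K
    induction k with
    | zero =>
      refine ⟨const X x, fun i => ?_, SimpleGraph.Reachable.refl _⟩
      exact (hN _ (by omega)).symm
    | succ k ih =>
      obtain ⟨δ, hδ, hr⟩ := ih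
      refine ⟨ofStep (fun i => γ.toFun (min i (min (2 * K - i) (N + (k + 1 : ℕ))))) ?_ ?_ ?_,
        fun i => rfl, SimpleGraph.Reachable.trans (reachable_of_forall fun i => ?_) hr⟩
      · intro i
        rcases lt_trichotomy (min (i + 1) (min (2 * K - (i + 1)) (N + (k + 1 : ℕ))))
          (min i (min (2 * K - i) (N + (k + 1 : ℕ)))) with h | h | h
        · have := γ.step (min (i + 1) (min (2 * K - (i + 1)) (N + (k + 1 : ℕ))))
          rw [show min (i + 1) (min (2 * K - (i + 1)) (N + (k + 1 : ℕ))) + 1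
            = min i (min (2 * K - i) (N + (k + 1 : ℕ))) by omega] at this
          exact this.imp Eq.symm (fun e => e.symm)
        · rw [h]; exact Or.inl rfl
        · have := γ.step (min i (min (2 * K - i) (N + (k + 1 : ℕ))))
          rwa [show min i (min (2 * K - i) (N + (k + 1 : ℕ))) + 1
            = min (i + 1) (min (2 * K - (i + 1)) (N + (k + 1 : ℕ))) by omega] at this
      · exact ⟨N, fun i hi => hN _ (by omega)⟩
      · exact ⟨2 * K - N, fun i hi => hN _ (by omega)⟩
      · rw [hδ i]
        simp only [ofStep]
        by_cases h : min i (min (2 * K - i) (N + (k + 1 : ℕ))) = min i (min (2 * K - i) (N + k))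
        · rw [h]; exact Or.inl rfl
        · have := γ.step (min i (min (2 * K - i) (N + k)))
          rw [show min i (min (2 * K - i) (N + k)) + 1
            = min i (min (2 * K - i) (N + (k + 1 : ℕ))) by omega] at this
          exact this.imp Eq.symm (fun e => e.symm)
  have hK : ∀ i ≥ max M N, γ.toFun i = x' := fun i hi => hM i (by omega)
  have hK' : ∀ i ≤ -(max M N), γ.inverse.toFun i = x' := fun i hi => hM (-i) (by omega)
  obtain ⟨δ, hδ, hr⟩ := fold (max M N - N).toNat (max M N)
  refine (concatAt_reachable _ _ _ _ _ _ _ _ hK hK').trans ?_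
  have e : concatAt γ γ.inverse (max M N) (-(max M N)) hK hK' = δ := by
    apply ext_fun
    intro i
    rw [hδ i]
    simp only [concatAt, inverse, ofStep]
    split_ifs with h <;> congr 1 <;> omega
  rw [e]
  exact hr

end InfPath

open InfPath in
/-- The first `A`-homotopy group `A₁(X, x₀)`: the set of path-components of the loop graph
`Ω_∞(X, x₀) = P_∞ X (x₀, x₀)`. -/
def A₁ {V : Type*} (X : SimpleGraph V) (x₀ : V) : Type _ :=
  (pathSpace X x₀ x₀).ConnectedComponent

namespace A₁

variable {V : Type*} {X : SimpleGraph V} {x₀ : V}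

/-- The class of a loop. -/
def mk (γ : InfPath X x₀ x₀) : A₁ X x₀ :=
  SimpleGraph.connectedComponentMk _ γ

/-- The group operation is induced by the concatenation of loops. -/
noncomputable instance : Mul (A₁ X x₀) where
  mul := Quot.map₂ InfPath.concat
    (fun γ _ _ h => InfPath.concat_reachable (SimpleGraph.Reachable.refl γ) h)
    (fun _ _ σ h => InfPath.concat_reachable h (SimpleGraph.Reachable.refl σ))

/-- The unit is the class of the constant loop. -/
instance : One (A₁ X x₀) where
  one := mk (InfPath.const X x₀)

/-- The inverse is induced by the inverse path. -/
instance : Inv (A₁ X x₀) where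
  inv := Quot.map InfPath.inverse (fun _ _ h => InfPath.inverse_reachable h)

theorem mk_mul_mk (γ σ : InfPath X x₀ x₀) : mk γ * mk σ = mk (γ.concat σ) := rfl

noncomputable instance : Group (A₁ X x₀) :=
  Group.ofLeftAxioms
    (by
      rintro ⟨a⟩ ⟨b⟩ ⟨c⟩
      exact Quot.sound (InfPath.concat_assoc a b c))
    (by
      rintro ⟨a⟩
      exact Quot.sound (InfPath.const_concat a))
    (by
      rintro ⟨a⟩
      have h := InfPath.concat_inverse a.inverse
      have e : a.inverse.inverse = a := by
        apply InfPath.ext_fun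
        intro i
        simp [InfPath.inverse, InfPath.ofStep]
      rw [e] at h
      exact Quot.sound h)

end A₁

/-! ### Colimits of graphs -/

/-- The identification of vertices in the pushout of `f : A → Y` and `g : A → Z`. -/
inductive PushoutRel {U V W : Type*} (f : U → V) (g : U → W) : V ⊕ W → V ⊕ W → Prop
  | glue (a : U) : PushoutRel f g (Sum.inl (f a)) (Sum.inr (g a))

/-- The vertices of the pushout of `f : A → Y` and `g : A → Z`. -/
def PushoutVertex {U V W : Type*} {A : SimpleGraph U} {Y : SimpleGraph V} {Z : SimpleGraph W}
    (f : GraphMap A Y) (g : GraphMap A Z) : Type _ :=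
  Quot (PushoutRel f.toFun g.toFun)

/-- The pushout of graphs: the vertices are the pushout of the vertex sets, and distinct vertices
are adjacent when they have adjacent representatives in `Y` or in `Z`. -/
def pushout {U V W : Type*} {A : SimpleGraph U} {Y : SimpleGraph V} {Z : SimpleGraph W}
    (f : GraphMap A Y) (g : GraphMap A Z) : SimpleGraph (PushoutVertex f g) :=
  (Y ⊕g Z).map (Quot.mk _)

section Pushout

variable {U V W : Type*} {A : SimpleGraph U} {Y : SimpleGraph V} {Z : SimpleGraph W}

/-- The structure map `Y → Y ⊔_A Z`. -/
def pushoutInl (f : GraphMap A Y) (g : GraphMap A Z) : GraphMap Y (pushout f g) where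
  toFun y := Quot.mk _ (Sum.inl y)
  map_adj a b h := by
    by_cases e : (Quot.mk _ (Sum.inl a) : PushoutVertex f g) = Quot.mk _ (Sum.inl b)
    · exact Or.inl e
    · exact Or.inr ⟨e, Sum.inl a, Sum.inl b, by simpa using h, rfl, rfl⟩

/-- The structure map `Z → Y ⊔_A Z`. -/
def pushoutInr (f : GraphMap A Y) (g : GraphMap A Z) : GraphMap Z (pushout f g) where
  toFun z := Quot.mk _ (Sum.inr z)
  map_adj a b h := by
    by_cases e : (Quot.mk _ (Sum.inr a) : PushoutVertex f g) = Quot.mk _ (Sum.inr b)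
    · exact Or.inl e
    · exact Or.inr ⟨e, Sum.inr a, Sum.inr b, by simpa using h, rfl, rfl⟩

end Pushout

/-- The coproduct of a family of graphs. -/
def coproduct {J : Type*} {V : J → Type*} (X : ∀ j, SimpleGraph (V j)) :
    SimpleGraph (Σ j, V j) where
  Adj p q := ∃ (j : J) (a b : V j), p = ⟨j, a⟩ ∧ q = ⟨j, b⟩ ∧ (X j).Adj a b
  symm := ⟨by
    rintro p q ⟨j, a, b, hp, hq, h⟩
    exact ⟨j, b, a, hq, hp, h.symm⟩⟩
  loopless := ⟨by
    rintro p ⟨j, a, b, hp, hq, h⟩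
    have e := hp.symm.trans hq
    simp only [Sigma.mk.injEq, heq_eq_eq, true_and] at e
    exact (X j).ne_of_adj h e⟩

/-- The map out of a coproduct given by a family of graph maps. -/
def coproductDesc {J W : Type*} {V : J → Type*} {X : ∀ j, SimpleGraph (V j)} {Y : SimpleGraph W}
    (f : ∀ j, GraphMap (X j) Y) : GraphMap (coproduct X) Y where
  toFun p := (f p.1).toFun p.2
  map_adj := by
    rintro _ _ ⟨j, a, b, rfl, rfl, h⟩
    exact (f j).map_adj h

/-- The map of coproducts given by a family of graph maps. -/
def coproductMap {J : Type*} {V W : J → Type*} {X : ∀ j, SimpleGraph (V j)}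
    {Y : ∀ j, SimpleGraph (W j)} (f : ∀ j, GraphMap (X j) (Y j)) :
    GraphMap (coproduct X) (coproduct Y) where
  toFun p := ⟨p.1, (f p.1).toFun p.2⟩
  map_adj := by
    rintro _ _ ⟨j, a, b, rfl, rfl, h⟩
    rcases (f j).map_adj h with e | e
    · exact Or.inl (by simp only [e])
    · exact Or.inr ⟨j, _, _, rfl, rfl, e⟩

/-! ### Cones, disks and wedges of circles -/

/-- The interval `I_n`: vertices `0, …, n`, edges `i ∼ i + 1`. -/
def interval (n : ℕ) : SimpleGraph (Fin (n + 1)) := SimpleGraph.pathGraph (n + 1)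

/-- The unique map to the one-vertex graph `I_0`. -/
def toPoint {V : Type*} (X : SimpleGraph V) : GraphMap X (interval 0) where
  toFun _ := 0
  map_adj _ _ _ := Or.inl rfl

open scoped SimpleGraph in
/-- The map `id ⊗ 0 : X □ I_0 → X □ I_n`. -/
def coneApexInclusion {V : Type*} (n : ℕ) (X : SimpleGraph V) :
    GraphMap (X □ interval 0) (X □ interval n) where
  toFun p := (p.1, 0)
  map_adj := by
    rintro ⟨a, i⟩ ⟨b, j⟩ h
    rw [SimpleGraph.boxProd_adj] at h
    rcases h with ⟨h, -⟩ | ⟨-, h⟩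
    · exact Or.inr (by rw [SimpleGraph.boxProd_adj]; exact Or.inl ⟨h, rfl⟩)
    · exact Or.inl (by simp_all)

open scoped SimpleGraph in
/-- The cone of height `n` on `X`: the pushout of `I_0 ← X □ I_0 → X □ I_n`. -/
def cone {V : Type*} (n : ℕ) (X : SimpleGraph V) :
    SimpleGraph (PushoutVertex (toPoint (X □ interval 0)) (coneApexInclusion n X)) :=
  pushout (toPoint (X □ interval 0)) (coneApexInclusion n X)

open scoped SimpleGraph in
/-- The inclusion `v ↦ (v, n)` of `X` as the base of its cone of height `n`. -/
def coneBase {V : Type*} (n : ℕ) (X : SimpleGraph V) : GraphMap X (cone n X) where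
  toFun v := (pushoutInr (toPoint (X □ interval 0)) (coneApexInclusion n X)).toFun (v, Fin.last n)
  map_adj _ _ h := (pushoutInr (toPoint (X □ interval 0)) (coneApexInclusion n X)).map_adj
    (by rw [SimpleGraph.boxProd_adj]; exact Or.inl ⟨h, rfl⟩)

open SimpleGraph (cycleGraph)

/-- The disk `D_{k,n}` with `k` spokes and of radius `n`. -/
abbrev disk (k n : ℕ) := cone n (cycleGraph k)

/-- The boundary `C_k → D_{k,n}`, `i ↦ (i, n)`. -/
def diskBoundary (k n : ℕ) : GraphMap (cycleGraph k) (disk k n) := coneBase n (cycleGraph k)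

/-- The map `∐_{i < m} I_0 → ∐_{i < m} C_5` picking the vertex `0` of each `C_5`. -/
def wedgeBasepoints (m : ℕ) :
    GraphMap (coproduct fun _ : Fin m => interval 0)
      (coproduct fun _ : Fin m => cycleGraph 5) :=
  coproductMap fun _ =>
    { toFun := fun _ => 0
      map_adj := fun _ _ _ => Or.inl rfl }

/-- The vertices of the wedge of `m` copies of `C_5`. -/
abbrev WedgeVertex (m : ℕ) :=
  PushoutVertex (wedgeBasepoints m) (toPoint (coproduct fun _ : Fin m => interval 0))

/-- The wedge of `m` copies of `C_5`, joined at the vertices `0`; one vertex if `m = 0`. -/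
def wedge (m : ℕ) : SimpleGraph (WedgeVertex m) :=
  pushout (wedgeBasepoints m) (toPoint (coproduct fun _ : Fin m => interval 0))

/-- The vertex `k` of the copy of `C_5` with index `s`. -/
def wedgePoint {m : ℕ} (s : Fin m) (k : Fin 5) : WedgeVertex m :=
  (pushoutInl (wedgeBasepoints m) (toPoint (coproduct fun _ : Fin m => interval 0))).toFun ⟨s, k⟩

/-! ### Words and the graph of a presentation -/

/-- A term `s_{i₁}^{d₁} ⋯ s_{iₖ}^{dₖ}` in `m` generators, as the list of the pairs `(iₗ, dₗ)`.
It need not be reduced. -/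
abbrev Word (m : ℕ) := List (Fin m × ℤ)

namespace Word

variable {m : ℕ}

/-- The element of the free group given by a term. -/
def eval (w : Word m) : FreeGroup (Fin m) := (w.map fun p => FreeGroup.of p.1 ^ p.2).prod

/-- The degree `|d₁| + ⋯ + |dₖ|`. -/
def deg (w : Word m) : ℕ := (w.map fun p => p.2.natAbs).sum

/-- The term written out letter by letter: `s^d` becomes `|d|` copies of `(s, sgn d)`. -/
def letters (w : Word m) : List (Fin m × ℤ) :=
  w.flatMap fun p => List.replicate p.2.natAbs (p.1, p.2.sign)

theorem length_letters (w : Word m) : w.letters.length = w.deg := by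
  simp [letters, deg, List.length_flatMap]

theorem sign_of_mem_letters {w : Word m} {p : Fin m × ℤ} (h : p ∈ w.letters) :
    p.2 = 1 ∨ p.2 = -1 := by
  simp only [letters, List.mem_flatMap, List.mem_replicate] at h
  obtain ⟨q, -, hq, rfl⟩ := h
  have : q.2 ≠ 0 := fun e => hq (by simp [e])
  rcases lt_or_gt_of_ne this with h | h
  · exact Or.inr (Int.sign_eq_neg_one_of_neg h)
  · exact Or.inl (Int.sign_eq_one_of_pos h)

/-- The letter of `w` traversed at time `i`; each letter takes five steps. -/
def letterAt (w : Word m) (i : Fin (5 * w.deg)) : Fin m × ℤ :=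
  w.letters.get ⟨i.val / 5, by rw [length_letters]; have := i.isLt; omega⟩

/-- The vertex map of `ε_w`: at time `i`, in a letter `s^{±1}`, the vertex `± i mod 5` of the copy
of `C_5` with index `s`. -/
def wrapFun (w : Word m) (i : Fin (5 * w.deg)) : WedgeVertex m :=
  wedgePoint (w.letterAt i).1 ((w.letterAt i).2 • Fin.ofNat 5 i.val)

end Word

theorem wedgePoint_zero {m : ℕ} (s t : Fin m) : wedgePoint s 0 = wedgePoint t 0 := by
  have h : ∀ u : Fin m, wedgePoint u 0 = Quot.mk _ (Sum.inr 0) := fun u =>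
    Quot.sound (PushoutRel.glue (⟨u, 0⟩ : Σ _ : Fin m, Fin 1))
  rw [h s, h t]

theorem wedgePoint_adj {m : ℕ} (s : Fin m) {k l : Fin 5} (h : (cycleGraph 5).Adj k l) :
    wedgePoint s k = wedgePoint s l ∨ (wedge m).Adj (wedgePoint s k) (wedgePoint s l) :=
  (pushoutInl (wedgeBasepoints m) _).map_adj ⟨s, k, l, rfl, rfl, h⟩

theorem wrapFun_step {m : ℕ} (w : Word m) (i j : Fin (5 * w.deg))
    (h : j.val = i.val + 1 ∨ (j.val = 0 ∧ i.val + 1 = 5 * w.deg)) :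
    w.wrapFun i = w.wrapFun j ∨ (wedge m).Adj (w.wrapFun i) (w.wrapFun j) := by
  have adj : ∀ (e : ℤ) (a b : ℕ), e = 1 ∨ e = -1 → b = a + 1 →
      (cycleGraph 5).Adj (e • Fin.ofNat 5 a) (e • Fin.ofNat 5 b) := by
    rintro e a b he rfl
    have h5 : Fin.ofNat 5 (a + 1) = Fin.ofNat 5 a + 1 := by
      apply Fin.ext; simp [Fin.ofNat, Fin.val_add]
    rw [h5]
    generalize Fin.ofNat 5 a = c
    rw [SimpleGraph.cycleGraph_adj]
    rcases he with rfl | rfl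
    · right; simp
    · left; simp
  have hs : ∀ k, (w.letterAt k).2 = 1 ∨ (w.letterAt k).2 = -1 := fun k =>
    Word.sign_of_mem_letters (List.get_mem _ _)
  have same : ∀ k : Fin (5 * w.deg), ∀ b : ℕ, b = k.val + 1 →
      w.wrapFun k = wedgePoint (w.letterAt k).1 ((w.letterAt k).2 • Fin.ofNat 5 b) ∨
      (wedge m).Adj (w.wrapFun k)
        (wedgePoint (w.letterAt k).1 ((w.letterAt k).2 • Fin.ofNat 5 b)) :=
    fun k b hb => wedgePoint_adj _ (adj _ _ _ (hs k) hb)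
  have zero : ∀ (e : ℤ) (a : ℕ), a % 5 = 0 → e • Fin.ofNat 5 a = 0 := by
    intro e a ha
    have : Fin.ofNat 5 a = 0 := Fin.ext ha
    rw [this, smul_zero]
  have target : w.wrapFun j
      = wedgePoint (w.letterAt i).1 ((w.letterAt i).2 • Fin.ofNat 5 (i.val + 1)) := by
    by_cases hj : j.val % 5 = 0
    · rw [zero _ (i.val + 1) (by omega), Word.wrapFun, zero _ _ hj]
      exact wedgePoint_zero _ _
    · have e1 : j.val = i.val + 1 := by omega
      have e2 : w.letterAt j = w.letterAt i := by
        unfold Word.letterAt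
        congr 2
        omega
      rw [Word.wrapFun, e2, e1]
  rw [target]
  exact same i _ rfl

/-- The map `ε_w : C_{5 deg w} → ⋁ C_5` which traverses the letters of `w` one after the other. -/
def wrap {m : ℕ} (w : Word m) : GraphMap (cycleGraph (5 * w.deg)) (wedge m) where
  toFun := w.wrapFun
  map_adj i j h := by
    have key : ∀ i j : Fin (5 * w.deg), (i - j).val = 1 →
        i.val = j.val + 1 ∨ (i.val = 0 ∧ j.val + 1 = 5 * w.deg) := by
      intro i j h
      have hi := i.isLt
      have hj := j.isLt
      rcases le_or_gt j i with hle | hlt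
      · rw [Fin.sub_val_of_le hle] at h
        have : j.val ≤ i.val := hle
        omega
      · rw [Fin.coe_sub_iff_lt.mpr hlt] at h
        have : i.val < j.val := hlt
        omega
    rw [SimpleGraph.cycleGraph_adj'] at h
    rcases h with h | h
    · exact (wrapFun_step w j i (key i j h)).imp Eq.symm (fun e => e.symm)
    · exact wrapFun_step w i j (key j i h)

/-- The map `∐_j C_{5 deg r_j} → ⋁_{i < m} C_5` with components `ε_{r_j}`. -/
def attachingMap {m n : ℕ} (r : Fin n → Word m) :
    GraphMap (coproduct fun j => cycleGraph (5 * (r j).deg)) (wedge m) :=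
  coproductDesc fun j => wrap (r j)

/-- The map `∐_j C_{5 deg r_j} → ∐_j D_{5 deg r_j, 3}` with components the boundaries. -/
def boundaryMap {m n : ℕ} (r : Fin n → Word m) :
    GraphMap (coproduct fun j => cycleGraph (5 * (r j).deg))
      (coproduct fun j => disk (5 * (r j).deg) 3) :=
  coproductMap fun j => diskBoundary (5 * (r j).deg) 3

/-- The vertices of the graph of the presentation `⟨s_1, …, s_m | r_1, …, r_n⟩`. -/
abbrev PresentationVertex {m n : ℕ} (r : Fin n → Word m) :=
  PushoutVertex (attachingMap r) (boundaryMap r)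

/-- The graph `X_{⟨S|R⟩}` of the presentation `⟨s_1, …, s_m | r_1, …, r_n⟩`. -/
def presentationGraph {m n : ℕ} (r : Fin n → Word m) : SimpleGraph (PresentationVertex r) :=
  pushout (attachingMap r) (boundaryMap r)

end DiscreteHomotopy

namespace DiscreteHomotopy

open InfPath
open SimpleGraph (cycleGraph)

/-! A labelling of the edges by group elements is flat if the two ways across every square,
degenerate or not, have the same product. Two adjacent loops bound a ladder of squares, so the
product of a flat labelling along a loop depends only on the class of the loop. This gives a
homomorphism `Labelling.holHom` from A₁(X, x), the holonomy.

The graph of a presentation has a flat labelling in the presented group (`coordLabel_square`). The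
edge closing the circle of s is labelled s, the other edges of the wedge and all edges inside the
disks are labelled 1, and the edge from a disk to its boundary vertex at time i is labelled by the
part of the relator read before time i. These prefixes close up around the disk because the relator
is 1 in the group. Circles of length five have no closed walk of length four that goes around, so
the wedge imposes no relation; radius three keeps the apex, which has no direction, away from the
edges with prefix labels.

The holonomy of this labelling is the required isomorphism. It is onto because the loop around the
circle of s has holonomy s. It is injective because the labelling is universal: any flat labelling L
arises from it by a homomorphism Ψ and a change of gauge (`presentationGauge_mul_label`). Here Ψ
sends s to the product of L around its circle, and Ψ respects the relators because L is flat on the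
disks, which shrink to their apices (`freeHolonomy_eval`). Applied to the tautological labelling by
classes of loops, whose holonomy is a conjugate of the class itself, this shows that a loop of
trivial holonomy is trivial in A₁ (`Labelling.holHom_injective`). -/

/-- Two vertices are near when they are equal or adjacent. -/
def Near {V : Type*} (X : SimpleGraph V) (a b : V) : Prop := a = b ∨ X.Adj a b

theorem Near.rfl {V : Type*} {X : SimpleGraph V} {a : V} : Near X a a := Or.inl (Eq.refl a)

theorem Near.symm {V : Type*} {X : SimpleGraph V} {a b : V} (h : Near X a b) : Near X b a :=
  h.imp Eq.symm fun e => e.symm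

/-! ### Flat labellings and their holonomy -/

/-- A labelling of the edges of a graph by elements of a group, for which the labels around each
(possibly degenerate) square multiply to one. -/
structure Labelling {V : Type*} (X : SimpleGraph V) (H : Type*) [Group H] where
  label : V → V → H
  self : ∀ a, label a a = 1
  square : ∀ {a b c d}, Near X a b → Near X b d → Near X a c → Near X c d →
    label a b * label b d = label a c * label c d

namespace Labelling

variable {V : Type*} {X : SimpleGraph V} {H K : Type*} [Group H] [Group K] {x x' x'' : V}

/-- The degenerate square whose two sides are a, b, a and a, a, a. -/
theorem mul_swap (L : Labelling X H) {a b : V} (h : Near X a b) :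
    L.label a b * L.label b a = 1 := by
  rw [L.square h h.symm Near.rfl Near.rfl, L.self, one_mul]

theorem swap (L : Labelling X H) {a b : V} (h : Near X a b) :
    L.label b a = (L.label a b)⁻¹ :=
  (inv_eq_of_mul_eq_one_right (L.mul_swap h)).symm

/-- The partial products of the labels along a path. -/
structure IsDevelopment (L : Labelling X H) (γ : InfPath X x x') (h : ℤ → H) (g : H) :
    Prop where
  left : ∃ N : ℤ, ∀ i ≤ N, h i = 1
  step : ∀ i, h (i + 1) = h i * L.label (γ.toFun i) (γ.toFun (i + 1))
  right : ∃ N : ℤ, ∀ i ≥ N, h i = g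

theorem exists_development (L : Labelling X H) (γ : InfPath X x x') :
    ∃ g h, L.IsDevelopment γ h g := by
  obtain ⟨N, hN⟩ := γ.eventually_left
  obtain ⟨M, hM⟩ := γ.eventually_right
  -- Before N the path is constant, and `toNat` makes the product empty there.
  let h : ℤ → H := fun i => ((List.range (i - N).toNat).map fun k : ℕ =>
    L.label (γ.toFun (N + k)) (γ.toFun (N + k + 1))).prod
  have hs : ∀ i, h (i + 1) = h i * L.label (γ.toFun i) (γ.toFun (i + 1)) := by
    intro i
    rcases lt_or_ge i N with hi | hi
    · have e1 : (i + 1 - N).toNat = 0 := by omega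
      have e2 : (i - N).toNat = 0 := by omega
      simp only [h, e1, e2]
      rw [hN i hi.le, hN (i + 1) (by omega), L.self, mul_one]
    · have e1 : (i + 1 - N).toNat = (i - N).toNat + 1 := by omega
      have e2 : N + ((i - N).toNat : ℤ) = i := by omega
      simp only [h, e1, List.range_succ, List.map_append, List.prod_append, List.map_cons,
        List.map_nil, List.prod_cons, List.prod_nil, mul_one, e2]
  refine ⟨h M, h, ⟨N, fun i hi => ?_⟩, hs, M, fun i hi => ?_⟩
  · have e : (i - N).toNat = 0 := by omega
    simp [h, e]
  · induction i, hi using Int.leInduction with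
    | base => rfl
    | succ i hi ih => rw [hs, ih, hM i hi, hM (i + 1) (by omega), L.self, mul_one]

/-- The rungs of the ladder between the two paths compare the partial products: flatness carries h i
* label (γ i) (σ i) = k i from each i to the next, and at both ends the rung is degenerate, with
label 1. -/
theorem IsDevelopment.eq_of_near {L : Labelling X H} {γ σ : InfPath X x x'} {h k : ℤ → H}
    {g g' : H} (hγ : L.IsDevelopment γ h g) (hσ : L.IsDevelopment σ k g')
    (H : ∀ i, Near X (γ.toFun i) (σ.toFun i)) : g = g' := by
  obtain ⟨N₁, h1⟩ := hγ.left
  obtain ⟨N₂, h2⟩ := hσ.left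
  obtain ⟨N₃, h3⟩ := γ.eventually_left
  obtain ⟨N₄, h4⟩ := σ.eventually_left
  obtain ⟨M₁, k1⟩ := hγ.right
  obtain ⟨M₂, k2⟩ := hσ.right
  obtain ⟨M₃, k3⟩ := γ.eventually_right
  obtain ⟨M₄, k4⟩ := σ.eventually_right
  set N := min (min N₁ N₂) (min N₃ N₄)
  have key : ∀ i ≥ N, h i * L.label (γ.toFun i) (σ.toFun i) = k i := by
    intro i hi
    induction i, hi using Int.leInduction with
    | base =>
      rw [h1 _ (by omega), h2 _ (by omega), h3 _ (by omega), h4 _ (by omega), L.self, one_mul]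
    | succ i hi ih =>
      rw [hγ.step, hσ.step, ← ih, mul_assoc, mul_assoc,
        L.square (γ.step i) (H (i + 1)) (H i) (σ.step i)]
  have := key (max (max N (max M₁ M₂)) (max M₃ M₄)) (by omega)
  rwa [k1 _ (by omega), k2 _ (by omega), k3 _ (by omega), k4 _ (by omega), L.self,
    mul_one] at this

/-- The product of the labels along a path. -/
noncomputable def hol (L : Labelling X H) (γ : InfPath X x x') : H :=
  (L.exists_development γ).choose

/-- Independence of the chosen development is the case of a path compared with itself. -/
theorem IsDevelopment.hol_eq {L : Labelling X H} {γ : InfPath X x x'} {h : ℤ → H} {g : H}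
    (hγ : L.IsDevelopment γ h g) : L.hol γ = g :=
  (L.exists_development γ).choose_spec.choose_spec.eq_of_near hγ fun _ => Near.rfl

theorem exists_isDevelopment_hol (L : Labelling X H) (γ : InfPath X x x') :
    ∃ h, L.IsDevelopment γ h (L.hol γ) :=
  (L.exists_development γ).choose_spec

theorem hol_eq_of_reachable (L : Labelling X H) {γ σ : InfPath X x x'}
    (h : (pathSpace X x x').Reachable γ σ) : L.hol γ = L.hol σ := by
  obtain ⟨p⟩ := h
  induction p with
  | nil => rfl
  | @cons γ σ _ h _ ih =>
    obtain ⟨k, hk⟩ := L.exists_isDevelopment_hol γ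
    obtain ⟨l, hl⟩ := L.exists_isDevelopment_hol σ
    exact (hk.eq_of_near hl h.2).trans ih

theorem hol_concat (L : Labelling X H) (γ : InfPath X x x') (σ : InfPath X x' x'') :
    L.hol (γ.concat σ) = L.hol γ * L.hol σ := by
  obtain ⟨k, hk⟩ := L.exists_isDevelopment_hol γ
  obtain ⟨l, hl⟩ := L.exists_isDevelopment_hol σ
  obtain ⟨N₁, k1⟩ := hk.left
  obtain ⟨M₁, k2⟩ := hk.right
  obtain ⟨N₂, l1⟩ := hl.left
  obtain ⟨M₂, l2⟩ := hl.right
  -- The cuts must come where the paths are constant and their partial products have stabilised as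
  -- well.
  set M := max M₁ γ.endTime
  set N := min N₂ σ.startTime
  have hM : ∀ i ≥ M, γ.toFun i = x' := fun i hi => γ.endTime_spec i (by omega)
  have hN : ∀ i ≤ N, σ.toFun i = x' := fun i hi => σ.startTime_spec i (by omega)
  have r : (pathSpace X x x'').Reachable (γ.concat σ) (concatAt γ σ M N hM hN) :=
    concatAt_reachable ..
  rw [L.hol_eq_of_reachable r]
  refine IsDevelopment.hol_eq
    (h := fun i => if i ≤ M then k i else L.hol γ * l (i - M + N)) ⟨?_, ?_, ?_⟩
  · exact ⟨min N₁ M, fun i hi => by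
      simp only [if_pos (show i ≤ M by omega)]; exact k1 _ (by omega)⟩
  · intro i
    simp only [concatAt, ofStep]
    rcases lt_trichotomy i M with h | h | h
    · rw [if_pos (by omega), if_pos (by omega), if_pos (by omega), if_pos (by omega), hk.step]
    · rw [if_neg (by omega), if_pos (by omega), if_pos (by omega), if_neg (by omega),
        show i + 1 - M + N = N + 1 by omega, hl.step, k2 i (by omega), l1 N (by omega),
        hM i (by omega), hN N le_rfl, one_mul]
    · rw [if_neg (by omega), if_neg (by omega), if_neg (by omega), if_neg (by omega),
        show i + 1 - M + N = i - M + N + 1 by omega, hl.step, mul_assoc]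
  · exact ⟨max (M + 1) (M₂ + M - N), fun i hi => by
      simp only [if_neg (show ¬ i ≤ M by omega)]; rw [l2 _ (by omega)]⟩

/-- The homomorphism from the fundamental group given by the product of the labels. -/
noncomputable def holHom (L : Labelling X H) (x : V) : A₁ X x →* H :=
  MonoidHom.mk' (Quot.lift (fun γ => L.hol γ) fun _ _ h => L.hol_eq_of_reachable h) (by
    rintro ⟨γ⟩ ⟨σ⟩
    exact L.hol_concat γ σ)

theorem holHom_mk (L : Labelling X H) (γ : InfPath X x x) : L.holHom x (A₁.mk γ) = L.hol γ := rfl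

/-- Along a path the intermediate values of u cancel, so only those at the two ends survive. -/
theorem hol_gauge (L : Labelling X H) (l : Labelling X K) (Ψ : K →* H) (u : V → H)
    (hu : ∀ a b, Near X a b → u a * L.label a b = Ψ (l.label a b) * u b)
    (γ : InfPath X x x') : u x * L.hol γ = Ψ (l.hol γ) * u x' := by
  obtain ⟨h, hh⟩ := L.exists_isDevelopment_hol γ
  obtain ⟨k, hk⟩ := l.exists_isDevelopment_hol γ
  obtain ⟨N₁, h1⟩ := hh.left
  obtain ⟨N₂, h2⟩ := hk.left
  obtain ⟨N₃, h3⟩ := γ.eventually_left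
  obtain ⟨M₁, k1⟩ := hh.right
  obtain ⟨M₂, k2⟩ := hk.right
  obtain ⟨M₃, k3⟩ := γ.eventually_right
  set N := min (min N₁ N₂) N₃
  have key : ∀ i ≥ N, u x * h i = Ψ (k i) * u (γ.toFun i) := by
    intro i hi
    induction i, hi using Int.leInduction with
    | base => rw [h1 _ (by omega), h2 _ (by omega), h3 _ (by omega), map_one, mul_one, one_mul]
    | succ i hi ih =>
      rw [hh.step, hk.step, ← mul_assoc, ih, map_mul, mul_assoc, mul_assoc, hu _ _ (γ.step i)]
  have := key (max (max N M₁) (max M₂ M₃)) (by omega)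
  rwa [k1 _ (by omega), k2 _ (by omega), k3 _ (by omega)] at this

end Labelling

/-! ### The path groupoid -/

section PathGroupoid

variable {V : Type*} {X : SimpleGraph V}

/-- The homotopy classes of paths between two vertices. -/
def PathClass (X : SimpleGraph V) (x y : V) := (pathSpace X x y).ConnectedComponent

/-- The homotopy class of a path. -/
def pathClass {x y : V} (γ : InfPath X x y) : PathClass X x y :=
  SimpleGraph.connectedComponentMk _ γ

theorem pathClass_eq {x y : V} {γ σ : InfPath X x y} (h : (pathSpace X x y).Reachable γ σ) :
    pathClass γ = pathClass σ := Quot.sound h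

theorem concat_const {x x' : V} (γ : InfPath X x x') :
    (pathSpace X x x').Reachable (γ.concat (const X x')) γ := by
  have e : concatAt γ (const X x') γ.endTime 0 γ.endTime_spec (fun _ _ => rfl) = γ := by
    apply ext_fun
    intro i
    simp only [concatAt, ofStep]
    split_ifs with h
    · rfl
    · exact (γ.endTime_spec i (by omega)).symm
  have r := concatAt_reachable γ (const X x') γ.endTime (const X x').startTime γ.endTime 0
    γ.endTime_spec (const X x').startTime_spec γ.endTime_spec (fun _ _ => rfl)
  rwa [e] at r

theorem inverse_inverse {x x' : V} (γ : InfPath X x x') : γ.inverse.inverse = γ := by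
  apply ext_fun
  intro i
  simp [InfPath.inverse, InfPath.ofStep]

namespace PathClass

/-- The class of the constant path. -/
def id (x : V) : PathClass X x x := pathClass (const X x)

/-- The composition of classes of paths. -/
noncomputable def comp {x y z : V} : PathClass X x y → PathClass X y z → PathClass X x z :=
  Quot.map₂ InfPath.concat
    (fun γ _ _ h => InfPath.concat_reachable (SimpleGraph.Reachable.refl γ) h)
    (fun _ _ σ h => InfPath.concat_reachable h (SimpleGraph.Reachable.refl σ))

/-- The inverse of a class of paths. -/
def inv {x y : V} : PathClass X x y → PathClass X y x :=
  Quot.map InfPath.inverse (fun _ _ h => InfPath.inverse_reachable h)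

scoped infixr:80 " ⬝ " => PathClass.comp

variable {x y z w : V}

theorem ind {P : PathClass X x y → Prop} (h : ∀ γ, P (pathClass γ)) (p) : P p := Quot.ind h p

@[simp]
theorem id_comp (p : PathClass X x y) : id x ⬝ p = p := by
  induction p using ind with | _ γ => exact pathClass_eq (const_concat γ)

@[simp]
theorem comp_id (p : PathClass X x y) : p ⬝ id y = p := by
  induction p using ind with | _ γ => exact pathClass_eq (concat_const γ)

@[simp]
theorem assoc (p : PathClass X x y) (q : PathClass X y z) (r : PathClass X z w) :
    (p ⬝ q) ⬝ r = p ⬝ q ⬝ r := by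
  induction p using ind with | _ γ =>
  induction q using ind with | _ σ =>
  induction r using ind with | _ τ => exact pathClass_eq (concat_assoc γ σ τ)

@[simp]
theorem comp_inv (p : PathClass X x y) : p ⬝ p.inv = id x := by
  induction p using ind with | _ γ => exact pathClass_eq (concat_inverse γ)

@[simp]
theorem inv_comp (p : PathClass X x y) : p.inv ⬝ p = id y := by
  induction p using ind with | _ γ =>
  have h := concat_inverse γ.inverse
  rw [inverse_inverse] at h
  exact pathClass_eq h

@[simp]
theorem inv_comp_assoc (p : PathClass X x y) (q : PathClass X y z) : p.inv ⬝ p ⬝ q = q := by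
  rw [← assoc, inv_comp, id_comp]

/-- A class of loops as an element of the fundamental group. -/
def toA₁ (p : PathClass X x x) : A₁ X x := p

theorem toA₁_mul (p q : PathClass X x x) : p.toA₁ * q.toA₁ = (p ⬝ q).toA₁ := rfl

theorem toA₁_id : (id x : PathClass X x x).toA₁ = 1 := rfl

theorem toA₁_injective : Function.Injective (toA₁ : PathClass X x x → A₁ X x) := fun _ _ h => h

end PathClass

open PathClass

theorem pathClass_concatAt {x x' x'' : V} (γ : InfPath X x x') (σ : InfPath X x' x'') (M N : ℤ)
    (hM : ∀ i ≥ M, γ.toFun i = x') (hN : ∀ i ≤ N, σ.toFun i = x') :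
    pathClass (concatAt γ σ M N hM hN) = pathClass γ ⬝ pathClass σ :=
  Quot.sound (concatAt_reachable ..)

/-- The path which moves from `a` to `b` right after time `k`. -/
def edgePath {a b : V} (h : Near X a b) (k : ℤ) : InfPath X a b :=
  ofStep (fun i => if i ≤ k then a else b)
    (fun i => by
      rcases lt_trichotomy i k with hi | hi | hi
      · exact Or.inl (by rw [if_pos (by omega), if_pos (by omega)])
      · rw [if_pos (by omega), if_neg (by omega)]; exact h
      · exact Or.inl (by rw [if_neg (by omega), if_neg (by omega)]))
    ⟨k, fun i hi => if_pos hi⟩ ⟨k + 1, fun i hi => if_neg (by omega)⟩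

/-- The class of an edge. -/
def edgeClass {a b : V} (h : Near X a b) : PathClass X a b :=
  pathClass (edgePath h 0)

/-- The two paths differ at time 1 only, where they take the near values b and a. -/
theorem edgeClass_eq_shift {a b : V} (h : Near X a b) :
    edgeClass h = pathClass (edgePath h 1) := by
  refine pathClass_eq (reachable_of_forall fun i => ?_)
  simp only [edgePath, ofStep]
  split_ifs
  · exact Near.rfl
  · omega
  · exact h.symm
  · exact Near.rfl

theorem edgeClass_self {a : V} (h : Near X a a) : edgeClass h = PathClass.id a := by
  refine pathClass_eq (reachable_of_forall fun i => Or.inl ?_)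
  simp [edgePath, ofStep, const]

/-- The vertices b and c need not be near, so the second path is delayed by one step: then b is
compared with a, and d with c. -/
theorem edgeClass_square {a b c d : V} (hab : Near X a b) (hbd : Near X b d) (hac : Near X a c)
    (hcd : Near X c d) : edgeClass hab ⬝ edgeClass hbd = edgeClass hac ⬝ edgeClass hcd := by
  rw [edgeClass_eq_shift hac]
  have h1 : ∀ i ≥ (1 : ℤ), (edgePath hab 0).toFun i = b := fun i hi => if_neg (by omega)
  have h2 : ∀ i ≥ (2 : ℤ), (edgePath hac 1).toFun i = c := fun i hi => if_neg (by omega)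
  have h3 : ∀ i ≤ (0 : ℤ), (edgePath hbd 0).toFun i = b := fun i hi => if_pos hi
  have h4 : ∀ i ≤ (0 : ℤ), (edgePath hcd 0).toFun i = c := fun i hi => if_pos hi
  simp only [edgeClass]
  rw [← pathClass_concatAt _ _ 1 0 h1 h3, ← pathClass_concatAt _ _ 2 0 h2 h4]
  refine pathClass_eq (reachable_of_forall fun i => ?_)
  simp only [concatAt, ofStep, edgePath]
  split_ifs <;> first | omega | exact Near.rfl | exact hab.symm | exact hcd.symm

/-- The path which follows `γ` up to time `k` and then stays. -/
def truncate {x x' : V} (γ : InfPath X x x') (k : ℤ) : InfPath X x (γ.toFun k) :=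
  ofStep (fun i => γ.toFun (min i k))
    (fun i => by
      rcases lt_or_ge i k with hi | hi
      · rw [min_eq_left hi.le, min_eq_left (by omega)]; exact γ.step i
      · exact Or.inl (by rw [min_eq_right hi, min_eq_right (by omega)]))
    (by
      obtain ⟨N, hN⟩ := γ.eventually_left
      exact ⟨N, fun i hi => hN _ (by omega)⟩)
    ⟨k, fun i hi => by rw [min_eq_right hi]⟩

theorem truncate_succ {x x' : V} (γ : InfPath X x x') (k : ℤ) :
    pathClass (truncate γ (k + 1)) = pathClass (truncate γ k) ⬝ edgeClass (γ.step k) := by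
  have h1 : ∀ i ≥ k, (truncate γ k).toFun i = γ.toFun k := fun i hi => by
    simp only [truncate, ofStep]; rw [min_eq_right hi]
  have h2 : ∀ i ≤ (0 : ℤ), (edgePath (γ.step k) 0).toFun i = γ.toFun k := fun i hi => if_pos hi
  unfold edgeClass
  rw [← pathClass_concatAt _ _ k 0 h1 h2]
  congr 1
  apply ext_fun
  intro i
  simp only [truncate, concatAt, ofStep, edgePath]
  split_ifs with h h'
  · congr 1; omega
  · omega
  · congr 1; omega

/-! ### The universal labelling, and criteria for injectivity and surjectivity of the holonomy -/

/-- A labelling by the fundamental group, given by a choice of a path to each vertex. -/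
noncomputable def universalLabelling (x : V) (t : ∀ v : V, PathClass X x v) :
    Labelling X (A₁ X x) where
  label a b := by
    classical exact if h : Near X a b then (t a ⬝ edgeClass h ⬝ (t b).inv).toA₁ else 1
  self a := by
    rw [dif_pos Near.rfl, edgeClass_self Near.rfl, id_comp, comp_inv, toA₁_id]
  square {a b c d} h1 h2 h3 h4 := by
    rw [dif_pos h1, dif_pos h2, dif_pos h3, dif_pos h4, toA₁_mul, toA₁_mul]
    simp only [assoc, inv_comp_assoc]
    rw [← assoc (edgeClass h1), edgeClass_square h1 h2 h3 h4, assoc]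

theorem universalLabelling_label {x : V} (t : ∀ v : V, PathClass X x v) {a b : V}
    (h : Near X a b) :
    (universalLabelling x t).label a b = (t a ⬝ edgeClass h ⬝ (t b).inv).toA₁ := by
  simp only [universalLabelling, dif_pos h]

/-- The partial products telescope to the classes of the truncations of γ, closed up by the chosen
paths. The path t x need not be trivial, hence the conjugation. -/
theorem universalLabelling_hol {x : V} (t : ∀ v : V, PathClass X x v) (γ : InfPath X x x) :
    (universalLabelling x t).hol γ = (t x ⬝ pathClass γ ⬝ (t x).inv).toA₁ := by
  -- A truncation ends at γ k, which equals x without being x by definition; the endpoint is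
  -- therefore a variable here, to be eliminated by `rfl`.
  have aux : ∀ (y : V) (δ : InfPath X x y), x = y → (∀ k, δ.toFun k = x) →
      (t x ⬝ pathClass δ ⬝ (t y).inv).toA₁ = 1 := by
    rintro _ δ rfl h
    obtain rfl : δ = const X x := ext_fun h
    change (t x ⬝ PathClass.id x ⬝ (t x).inv).toA₁ = 1
    rw [id_comp, comp_inv, toA₁_id]
  have aux' : ∀ (y : V) (δ : InfPath X x y), x = y → (∀ k, δ.toFun k = γ.toFun k) →
      (t x ⬝ pathClass δ ⬝ (t y).inv).toA₁ = (t x ⬝ pathClass γ ⬝ (t x).inv).toA₁ := by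
    rintro _ δ rfl h
    rw [ext_fun h]
  obtain ⟨N, hN⟩ := γ.eventually_left
  obtain ⟨M, hM⟩ := γ.eventually_right
  refine Labelling.IsDevelopment.hol_eq (h := fun i =>
    (t x ⬝ pathClass (truncate γ i) ⬝ (t (γ.toFun i)).inv).toA₁) ⟨?_, ?_, ?_⟩
  · exact ⟨N, fun i hi => aux _ _ (hN i hi).symm fun k => hN _ (by omega)⟩
  · intro i
    rw [truncate_succ, universalLabelling_label t (γ.step i), toA₁_mul]
    simp only [assoc, inv_comp_assoc]
  · refine ⟨M, fun i hi => aux' _ _ (hM i hi).symm fun k => ?_⟩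
    simp only [truncate, ofStep]
    rcases le_or_gt k i with h | h
    · rw [min_eq_left h]
    · rw [min_eq_right h.le, hM _ hi, hM _ (by omega)]

theorem nonempty_infPath {x y : V} (h : X.Reachable x y) : Nonempty (InfPath X x y) := by
  obtain ⟨p⟩ := h
  induction p with
  | nil => exact ⟨const X _⟩
  | cons h _ ih => exact ih.map fun γ => (edgePath (Or.inr h) 0).concat γ

/-- A labelling from which every labelling arises, up to a change of gauge, by applying a group
homomorphism detects the homotopy classes of loops. -/
theorem Labelling.holHom_injective {K : Type*} [Group K] (l : Labelling X K)
    (hX : X.Preconnected) (x : V)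
    (hl : ∀ L : Labelling X (A₁ X x), ∃ (Ψ : K →* A₁ X x) (u : V → A₁ X x),
      ∀ a b, Near X a b → u a * L.label a b = Ψ (l.label a b) * u b) :
    Function.Injective (l.holHom x) := by
  let t : ∀ v : V, PathClass X x v := fun v =>
    pathClass (nonempty_infPath (hX x v)).some
  obtain ⟨Ψ, u, hu⟩ := hl (universalLabelling x t)
  rw [injective_iff_map_eq_one]
  rintro ⟨γ⟩ hγ
  have h := (universalLabelling x t).hol_gauge l Ψ u hu γ
  have hγ' : l.hol γ = 1 := hγ
  -- A loop starts and ends with the same gauge u x, so a trivial holonomy for l forces a trivial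
  -- one for the universal labelling. What remains is to undo the conjugation by t x.
  rw [hγ', map_one, one_mul, mul_eq_left, universalLabelling_hol] at h
  rw [← toA₁_id] at h
  have h' := toA₁_injective h
  have e : pathClass γ = (t x).inv ⬝ (t x ⬝ pathClass γ ⬝ (t x).inv) ⬝ t x := by simp
  rw [h', id_comp, inv_comp] at e
  exact congrArg toA₁ e

/-- Change of base point: conjugation by the holonomy of a path from x to y. -/
theorem Labelling.holHom_surjective {K : Type*} [Group K] (l : Labelling X K)
    (hX : X.Preconnected) {x y : V} (h : Function.Surjective (l.holHom y)) :
    Function.Surjective (l.holHom x) := by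
  intro g
  obtain ⟨p⟩ := nonempty_infPath (hX x y)
  obtain ⟨⟨q⟩, hq⟩ := h ((l.hol p)⁻¹ * g * l.hol p)
  have hq' : l.hol q = (l.hol p)⁻¹ * g * l.hol p := hq
  have h1 : l.hol p * l.hol p.inverse = 1 := by
    rw [← l.hol_concat, l.hol_eq_of_reachable (concat_inverse p)]
    exact (l.holHom x).map_one
  refine ⟨A₁.mk (p.concat (q.concat p.inverse)), ?_⟩
  rw [l.holHom_mk, l.hol_concat, l.hol_concat, hq', eq_inv_of_mul_eq_one_right h1]
  group

end PathGroupoid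

/-! ### Vertices and edges of the graph of a presentation -/

section Pushout

variable {U V W : Type*} {A : SimpleGraph U} {Y : SimpleGraph V} {Z : SimpleGraph W}
  {f : GraphMap A Y} {g : GraphMap A Z}

theorem pushout_condition (a : U) :
    (pushoutInl f g).toFun (f.toFun a) = (pushoutInr f g).toFun (g.toFun a) :=
  Quot.sound (PushoutRel.glue a)

theorem pushoutVertex_cases (p : PushoutVertex f g) :
    (∃ a, p = (pushoutInl f g).toFun a) ∨ ∃ b, p = (pushoutInr f g).toFun b := by
  obtain ⟨a | b⟩ := p
  · exact Or.inl ⟨a, rfl⟩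
  · exact Or.inr ⟨b, rfl⟩

theorem pushout_adj_cases {p q : PushoutVertex f g} (h : (pushout f g).Adj p q) :
    (∃ a b, Y.Adj a b ∧ p = (pushoutInl f g).toFun a ∧ q = (pushoutInl f g).toFun b) ∨
    ∃ a b, Z.Adj a b ∧ p = (pushoutInr f g).toFun a ∧ q = (pushoutInr f g).toFun b := by
  obtain ⟨-, a | a, b | b, hab, rfl, rfl⟩ := h
  · exact Or.inl ⟨a, b, by simpa using hab, rfl, rfl⟩
  · simp at hab
  · simp at hab
  · exact Or.inr ⟨a, b, by simpa using hab, rfl, rfl⟩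

end Pushout

theorem wedge_adj_cases {m : ℕ} {a b : WedgeVertex m} (h : (wedge m).Adj a b) :
    ∃ s k l, (cycleGraph 5).Adj k l ∧ a = wedgePoint s k ∧ b = wedgePoint s l := by
  rcases pushout_adj_cases h with ⟨_, _, ⟨s, k, l, rfl, rfl, hkl⟩, rfl, rfl⟩ | ⟨a, b, hab, -⟩
  · exact ⟨s, k, l, hkl, rfl, rfl⟩
  · exact absurd (Subsingleton.elim (α := Fin 1) a b) hab.ne

/-- The joint vertex of a wedge of circles. -/
def wedgeBase (m : ℕ) : WedgeVertex m :=
  (pushoutInr (wedgeBasepoints m) (toPoint (coproduct fun _ : Fin m => interval 0))).toFun 0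

theorem wedgePoint_zero_eq {m : ℕ} (s : Fin m) : wedgePoint s 0 = wedgeBase m :=
  Quot.sound (PushoutRel.glue (⟨s, 0⟩ : Σ _ : Fin m, Fin 1))

theorem wedgeVertex_cases {m : ℕ} (a : WedgeVertex m) :
    a = wedgeBase m ∨ ∃ s k, a = wedgePoint s k := by
  rcases pushoutVertex_cases a with ⟨⟨s, k⟩, rfl⟩ | ⟨b, rfl⟩
  · exact Or.inr ⟨s, k, rfl⟩
  · exact Or.inl (by rw [Subsingleton.elim (α := Fin 1) b 0]; rfl)

/-- The vertex `(i, l)` of a disk. -/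
def diskPoint (k n : ℕ) (i : Fin k) (l : Fin (n + 1)) :
    PushoutVertex (toPoint (cycleGraph k □ interval 0)) (coneApexInclusion n (cycleGraph k)) :=
  (pushoutInr (toPoint _) (coneApexInclusion n (cycleGraph k))).toFun (i, l)

/-- The apex of a disk. -/
def diskApex (k n : ℕ) :
    PushoutVertex (toPoint (cycleGraph k □ interval 0)) (coneApexInclusion n (cycleGraph k)) :=
  (pushoutInl (toPoint _) (coneApexInclusion n (cycleGraph k))).toFun 0

theorem diskPoint_zero {k n : ℕ} (i : Fin k) : diskPoint k n i 0 = diskApex k n :=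
  (pushout_condition (f := toPoint (cycleGraph k □ interval 0))
    (g := coneApexInclusion n (cycleGraph k)) (i, 0)).symm

theorem disk_adj_cases {k n : ℕ} {p q} (h : (disk k n).Adj p q) :
    ∃ i l i' l', ((cycleGraph k).Adj i i' ∧ l = l' ∨ i = i' ∧
      (l.val + 1 = l'.val ∨ l'.val + 1 = l.val)) ∧
      p = diskPoint k n i l ∧ q = diskPoint k n i' l' := by
  rcases pushout_adj_cases h with ⟨a, b, hab, -⟩ | ⟨⟨i, l⟩, ⟨i', l'⟩, hb, rfl, rfl⟩
  · exact absurd (Subsingleton.elim (α := Fin 1) a b) hab.ne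
  · refine ⟨i, l, i', l', ?_, rfl, rfl⟩
    rw [SimpleGraph.boxProd_adj] at hb
    rcases hb with ⟨h, e⟩ | ⟨h, e⟩
    · exact Or.inl ⟨h, e⟩
    · exact Or.inr ⟨e, SimpleGraph.pathGraph_adj.mp h⟩

/-- The vertex `j` follows the vertex `i` on the cycle with `k` vertices. -/
def CycleSucc (k i j : ℕ) : Prop := j = i + 1 ∧ j < k ∨ j = 0 ∧ i + 1 = k

theorem cycleGraph_adj_cases {k : ℕ} {i j : Fin k} (h : (cycleGraph k).Adj i j) :
    CycleSucc k i j ∨ CycleSucc k j i := by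
  have key : ∀ i j : Fin k, (i - j).val = 1 → CycleSucc k j i := by
    intro i j h
    have hi := i.isLt
    have hj := j.isLt
    unfold CycleSucc
    rcases le_or_gt j i with hle | hlt
    · rw [Fin.sub_val_of_le hle] at h
      have : j.val ≤ i.val := hle
      omega
    · rw [Fin.coe_sub_iff_lt.mpr hlt] at h
      have : i.val < j.val := hlt
      omega
  rw [SimpleGraph.cycleGraph_adj'] at h
  exact h.symm.imp (key j i) (key i j)

/-- Only nearness holds in general: for k = 1 the vertex 0 is its own successor. -/
theorem adj_of_cycleSucc {k : ℕ} {i j : Fin k} (h : CycleSucc k i j) :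
    Near (cycleGraph k) i j := by
  have hi := i.isLt
  have hj := j.isLt
  by_cases e : i = j
  · exact Or.inl e
  refine Or.inr ?_
  have e' : i.val ≠ j.val := fun h => e (Fin.ext h)
  rw [SimpleGraph.cycleGraph_adj']
  right
  unfold CycleSucc at h
  rcases lt_or_gt_of_ne e' with hlt | hlt
  · rw [Fin.sub_val_of_le (show i ≤ j from hlt.le)]; omega
  · rw [Fin.coe_sub_iff_lt.mpr (show j < i from hlt)]; omega

section Presentation

variable {m n : ℕ} (r : Fin n → Word m)

/-- The vertices of the wedge of circles in the graph of a presentation. -/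
def ofWedge : GraphMap (wedge m) (presentationGraph r) :=
  pushoutInl (attachingMap r) (boundaryMap r)

/-- The vertex `(i, l)` of the disk with index `j` in the graph of a presentation. -/
def ofDisk (j : Fin n) (i : Fin (5 * (r j).deg)) (l : Fin 4) : PresentationVertex r :=
  (pushoutInr (attachingMap r) (boundaryMap r)).toFun ⟨j, diskPoint _ 3 i l⟩

theorem ofDisk_three (j : Fin n) (i : Fin (5 * (r j).deg)) :
    ofDisk r j i 3 = (ofWedge r).toFun ((r j).wrapFun i) :=
  (pushout_condition (f := attachingMap r) (g := boundaryMap r) ⟨j, i⟩).symm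

theorem ofDisk_zero (j : Fin n) (i i' : Fin (5 * (r j).deg)) :
    ofDisk r j i 0 = ofDisk r j i' 0 := by
  simp only [ofDisk, diskPoint_zero]

/-- The oriented edges of the graph of a presentation. -/
inductive PresentationEdge : PresentationVertex r → PresentationVertex r → Prop
  | wedge (s : Fin m) (k : Fin 5) : PresentationEdge ((ofWedge r).toFun (wedgePoint s k))
      ((ofWedge r).toFun (wedgePoint s (k + 1)))
  | outer (j : Fin n) (i : Fin (5 * (r j).deg)) : PresentationEdge (ofDisk r j i 2)
      ((ofWedge r).toFun ((r j).wrapFun i))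
  | middle (j : Fin n) (i : Fin (5 * (r j).deg)) : PresentationEdge (ofDisk r j i 2)
      (ofDisk r j i 1)
  | inner (j : Fin n) (i : Fin (5 * (r j).deg)) : PresentationEdge (ofDisk r j i 1)
      (ofDisk r j i 0)
  | ring (j : Fin n) (i i' : Fin (5 * (r j).deg)) (l : Fin 4) (hl : l = 1 ∨ l = 2)
      (h : CycleSucc (5 * (r j).deg) i i') : PresentationEdge (ofDisk r j i l) (ofDisk r j i' l)

variable {r}

theorem ofDisk_adj {j : Fin n} {i i' : Fin (5 * (r j).deg)} {l l' : Fin 4}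
    (h : (cycleGraph _).Adj i i' ∧ l = l' ∨ i = i' ∧
      (l.val + 1 = l'.val ∨ l'.val + 1 = l.val)) :
    Near (presentationGraph r) (ofDisk r j i l) (ofDisk r j i' l') := by
  have h1 : (cycleGraph (5 * (r j).deg) □ interval 3).Adj (i, l) (i', l') := by
    rw [SimpleGraph.boxProd_adj]
    rcases h with ⟨h, e⟩ | ⟨e, h⟩
    · exact Or.inl ⟨h, e⟩
    · exact Or.inr ⟨SimpleGraph.pathGraph_adj.mpr h, e⟩
  rcases (pushoutInr (toPoint _) (coneApexInclusion 3 _)).map_adj h1 with e | e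
  · exact Or.inl (congrArg (fun v => (pushoutInr (attachingMap r) (boundaryMap r)).toFun ⟨j, v⟩) e)
  · exact (pushoutInr (attachingMap r) (boundaryMap r)).map_adj ⟨j, _, _, rfl, rfl, e⟩

theorem PresentationEdge.near {a b : PresentationVertex r} (h : PresentationEdge r a b) :
    Near (presentationGraph r) a b := by
  induction h with
  | wedge s k =>
    have h1 : (cycleGraph 5).Adj k (k + 1) := by
      rw [SimpleGraph.cycleGraph_adj]; right; simp
    rcases wedgePoint_adj s h1 with e | e
    · rw [e]; exact Near.rfl
    · exact (ofWedge r).map_adj e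
  | outer j i => rw [← ofDisk_three]; exact ofDisk_adj (Or.inr ⟨rfl, Or.inl rfl⟩)
  | middle j i => exact ofDisk_adj (Or.inr ⟨rfl, Or.inr rfl⟩)
  | inner j i => exact ofDisk_adj (Or.inr ⟨rfl, Or.inr rfl⟩)
  | ring j i i' l hl h =>
    rcases adj_of_cycleSucc h with e | e
    · rw [e]; exact Near.rfl
    · exact ofDisk_adj (Or.inl ⟨e, rfl⟩)

theorem ofWedge_adj_cases {a b : WedgeVertex m} (h : Near (wedge m) a b) :
    (ofWedge r).toFun a = (ofWedge r).toFun b ∨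
    PresentationEdge r ((ofWedge r).toFun a) ((ofWedge r).toFun b) ∨
    PresentationEdge r ((ofWedge r).toFun b) ((ofWedge r).toFun a) := by
  rcases h with rfl | h
  · exact Or.inl rfl
  · obtain ⟨s, k, l, hkl, rfl, rfl⟩ := wedge_adj_cases h
    rw [SimpleGraph.cycleGraph_adj] at hkl
    rcases hkl with h | h
    · obtain rfl : k = l + 1 := by rw [← h]; abel
      exact Or.inr (Or.inr (.wedge s l))
    · obtain rfl : l = k + 1 := by rw [← h]; abel
      exact Or.inr (Or.inl (.wedge s k))

/-- The rings of a disk at heights 0 and 3 contribute no new edges: the first collapses to the apex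
and the second lies in the wedge. -/
theorem near_cases {a b : PresentationVertex r} (h : Near (presentationGraph r) a b) :
    a = b ∨ PresentationEdge r a b ∨ PresentationEdge r b a := by
  rcases h with rfl | hadj
  · exact Or.inl rfl
  rcases pushout_adj_cases hadj with ⟨a, b, hab, rfl, rfl⟩ | ⟨_, _, ⟨j, a, b, rfl, rfl, hab⟩, rfl, rfl⟩
  · exact ofWedge_adj_cases (Or.inr hab)
  · obtain ⟨i, l, i', l', h, rfl, rfl⟩ := disk_adj_cases hab
    change ofDisk r j i l = ofDisk r j i' l' ∨ PresentationEdge r (ofDisk r j i l) (ofDisk r j i' l')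
      ∨ PresentationEdge r (ofDisk r j i' l') (ofDisk r j i l)
    rcases h with ⟨h, rfl⟩ | ⟨rfl, h⟩
    · have ring : ∀ l : Fin 4, l = 1 ∨ l = 2 →
          PresentationEdge r (ofDisk r j i l) (ofDisk r j i' l) ∨
          PresentationEdge r (ofDisk r j i' l) (ofDisk r j i l) := fun l hl =>
        (cycleGraph_adj_cases h).imp (.ring j i i' l hl) (.ring j i' i l hl)
      match l with
      | 0 => exact Or.inl (ofDisk_zero r j i i')
      | 1 => exact Or.inr (ring 1 (Or.inl rfl))
      | 2 => exact Or.inr (ring 2 (Or.inr rfl))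
      | 3 =>
        rw [ofDisk_three, ofDisk_three]
        exact ofWedge_adj_cases ((wrap (r j)).map_adj h)
    · have spoke : ∀ l l' : Fin 4, l.val + 1 = l'.val →
          PresentationEdge r (ofDisk r j i l') (ofDisk r j i l) ∨
          PresentationEdge r (ofDisk r j i l) (ofDisk r j i l') := by
        intro l l' h
        match l with
        | 0 =>
          obtain rfl : l' = 1 := Fin.ext (by simpa using h.symm)
          exact Or.inl (.inner j i)
        | 1 =>
          obtain rfl : l' = 2 := Fin.ext (by simpa using h.symm)
          exact Or.inl (.middle j i)
        | 2 =>
          obtain rfl : l' = 3 := Fin.ext (by simpa using h.symm)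
          rw [ofDisk_three]
          exact Or.inr (.outer j i)
        | 3 => have := l'.isLt; simp at h; omega
      rcases h with h | h
      · exact Or.inr (spoke _ _ h).symm
      · exact Or.inr (spoke _ _ h)

/-- Positive degree matters: the cone over an empty cycle is a lone apex, not of the form (i, l) and
not joined to the wedge. -/
theorem presentationVertex_cases (hr : ∀ j, 0 < (r j).deg) (v : PresentationVertex r) :
    (∃ a, v = (ofWedge r).toFun a) ∨ ∃ j i l, v = ofDisk r j i l := by
  rcases pushoutVertex_cases v with ⟨a, rfl⟩ | ⟨⟨j, d⟩, rfl⟩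
  · exact Or.inl ⟨a, rfl⟩
  · refine Or.inr ⟨j, ?_⟩
    have hj := hr j
    rcases pushoutVertex_cases d with ⟨a, rfl⟩ | ⟨⟨i, l⟩, rfl⟩
    · refine ⟨⟨0, by omega⟩, 0, ?_⟩
      rw [Subsingleton.elim (α := Fin 1) a 0, ofDisk, diskPoint_zero]
      rfl
    · exact ⟨i, l, rfl⟩

theorem Near.reachable {V : Type*} {X : SimpleGraph V} {a b : V} (h : Near X a b) :
    X.Reachable a b := by
  rcases h with rfl | h
  · exact SimpleGraph.Reachable.refl _
  · exact h.reachable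

theorem presentationGraph_preconnected (hr : ∀ j, 0 < (r j).deg) :
    (presentationGraph r).Preconnected := by
  have hp : ∀ s (k : ℕ), (presentationGraph r).Reachable
      ((ofWedge r).toFun (wedgeBase m)) ((ofWedge r).toFun (wedgePoint s (Fin.ofNat 5 k))) := by
    intro s k
    induction k with
    | zero =>
      rw [show Fin.ofNat 5 0 = 0 from rfl, wedgePoint_zero_eq]
    | succ k ih =>
      rw [show Fin.ofNat 5 (k + 1) = Fin.ofNat 5 k + 1 from Fin.ext (by simp [Fin.val_add])]
      exact ih.trans (PresentationEdge.wedge s _).near.reachable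
  have hw : ∀ a, (presentationGraph r).Reachable
      ((ofWedge r).toFun (wedgeBase m)) ((ofWedge r).toFun a) := by
    intro a
    rcases wedgeVertex_cases a with rfl | ⟨s, k, rfl⟩
    · exact SimpleGraph.Reachable.refl _
    · have := hp s k.val
      rwa [show Fin.ofNat 5 k.val = k from Fin.ext (Nat.mod_eq_of_lt k.isLt)] at this
  have h : ∀ v, (presentationGraph r).Reachable ((ofWedge r).toFun (wedgeBase m)) v := by
    intro v
    rcases presentationVertex_cases hr v with ⟨a, rfl⟩ | ⟨j, i, l, rfl⟩
    · exact hw a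
    · have h2 := (hw _).trans (PresentationEdge.outer j i).near.symm.reachable
      have h1 := h2.trans (PresentationEdge.middle j i).near.reachable
      match l with
      | 0 => exact h1.trans (PresentationEdge.inner j i).near.reachable
      | 1 => exact h1
      | 2 => exact h2
      | 3 => rw [ofDisk_three]; exact hw _
  exact fun a b => (h a).symm.trans (h b)

end Presentation

/-! ### Coordinates and labels on the wedge of circles -/

section Wedge

variable {m : ℕ}

/-- The vertex `k` of the copy of the circle with index `s`; the joint vertex is `none`. -/
def circleCoord (s : Fin m) (k : ℕ) : Option (Fin m × ℕ) := if k = 0 then none else some (s, k)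

/-- The coordinates of a vertex of a wedge of circles. -/
def wedgeCoord : WedgeVertex m → Option (Fin m × ℕ) :=
  Quot.lift (Sum.elim (fun p => circleCoord p.1 p.2.val) fun _ => none) (by
    rintro _ _ ⟨⟨s, u⟩⟩
    rfl)

theorem wedgeCoord_wedgePoint (s : Fin m) (k : Fin 5) :
    wedgeCoord (wedgePoint s k) = circleCoord s k.val := rfl

/-- The relation of equality or adjacency in coordinates. -/
def WedgeNear : Option (Fin m × ℕ) → Option (Fin m × ℕ) → Prop
  | none, none => True
  | none, some (_, k) => k = 1 ∨ k = 4
  | some (_, k), none => k = 1 ∨ k = 4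
  | some (s, k), some (t, l) => s = t ∧ (k = l ∨ k + 1 = l ∨ l + 1 = k)

theorem WedgeNear.refl (a : Option (Fin m × ℕ)) : WedgeNear a a := by
  rcases a with _ | ⟨s, k⟩ <;> simp [WedgeNear]

theorem WedgeNear.symm {a b : Option (Fin m × ℕ)} (h : WedgeNear a b) : WedgeNear b a := by
  rcases a with _ | ⟨s, k⟩ <;> rcases b with _ | ⟨t, l⟩ <;> simp only [WedgeNear] at h ⊢
  · exact h
  · exact h
  · exact ⟨h.1.symm, by omega⟩

theorem wedgeNear_circleCoord (s : Fin m) (k : Fin 5) :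
    WedgeNear (circleCoord s k.val) (circleCoord s (k + 1).val) := by
  fin_cases k <;> simp [circleCoord, WedgeNear]

/-- The label of an edge of a wedge of circles: the edge which closes a circle is labelled by the
generator, the others by one. -/
def wedgeLabel : Option (Fin m × ℕ) → Option (Fin m × ℕ) → FreeGroup (Fin m)
  | none, none => 1
  | none, some (s, k) => if k = 4 then (FreeGroup.of s)⁻¹ else 1
  | some (s, k), none => if k = 4 then FreeGroup.of s else 1
  | some _, some _ => 1

theorem wedgeLabel_self (a : Option (Fin m × ℕ)) : wedgeLabel a a = 1 := by
  rcases a with _ | ⟨s, k⟩ <;> rfl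

theorem wedgeLabel_mul_swap (a b : Option (Fin m × ℕ)) :
    wedgeLabel a b * wedgeLabel b a = 1 := by
  rcases a with _ | ⟨s, k⟩ <;> rcases b with _ | ⟨t, l⟩ <;> simp only [wedgeLabel, mul_one]
  all_goals split_ifs <;> simp

/-- This is where the length five enters. A square through the closing edge that does not cancel
would have to pass between the neighbours 1 and 4 of the joint vertex inside a circle, which takes
three steps when only two are left. -/
theorem wedgeLabel_square {a b c d : Option (Fin m × ℕ)} (hab : WedgeNear a b)
    (hbd : WedgeNear b d) (hac : WedgeNear a c) (hcd : WedgeNear c d) :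
    wedgeLabel a b * wedgeLabel b d = wedgeLabel a c * wedgeLabel c d := by
  rcases a with _ | ⟨s, i⟩ <;> rcases b with _ | ⟨t, j⟩ <;> rcases c with _ | ⟨u, k⟩ <;>
    rcases d with _ | ⟨v, l⟩ <;> simp only [WedgeNear] at hab hbd hac hcd <;>
    simp only [wedgeLabel, mul_one, one_mul] <;>
    grind [mul_inv_cancel, inv_mul_cancel]

end Wedge

/-! ### The labels along the boundary of a disk -/

namespace Word

variable {m : ℕ} (w : Word m)

/-- The vertex of the wedge of circles at which `ε_w` is at time `t`. -/
def boundaryPoint (t : ℕ) : WedgeVertex m :=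
  if h : 0 < 5 * w.deg then w.wrapFun ⟨t % (5 * w.deg), Nat.mod_lt _ h⟩ else wedgeBase m

theorem boundaryPoint_val (i : Fin (5 * w.deg)) : w.boundaryPoint i.val = w.wrapFun i := by
  rw [boundaryPoint, dif_pos i.pos]
  congr 1
  exact Fin.ext (Nat.mod_eq_of_lt i.isLt)

theorem boundaryPoint_deg : w.boundaryPoint (5 * w.deg) = w.boundaryPoint 0 := by
  simp [boundaryPoint]

/-- The product of the labels along `ε_w` up to time `t`. -/
def prefixLabel : ℕ → FreeGroup (Fin m)
  | 0 => 1
  | t + 1 => prefixLabel t *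
      wedgeLabel (wedgeCoord (w.boundaryPoint t)) (wedgeCoord (w.boundaryPoint (t + 1)))

theorem wedgeCoord_boundaryPoint {q k : ℕ} (hq : q < w.letters.length) (hk : k < 5) :
    wedgeCoord (w.boundaryPoint (5 * q + k)) =
      circleCoord w.letters[q].1 (w.letters[q].2 • Fin.ofNat 5 k).val := by
  have hq' : q < w.deg := by rwa [← w.length_letters]
  have h : 5 * q + k < 5 * w.deg := by omega
  rw [w.boundaryPoint_val ⟨5 * q + k, h⟩, wrapFun, wedgeCoord_wedgePoint, letterAt]
  have e1 : (5 * q + k) / 5 = q := by omega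
  have e2 : Fin.ofNat 5 (5 * q + k) = Fin.ofNat 5 k := Fin.ext (by simp)
  simp only [List.get_eq_getElem, e1, e2]

theorem wedgeCoord_boundaryPoint_mul (q : ℕ) :
    wedgeCoord (w.boundaryPoint (5 * q)) = none := by
  unfold boundaryPoint
  split_ifs with h
  -- Since 5q mod 5 deg w = 5 (q mod deg w), the end of the word and later turns are covered too.
  · have e : Fin.ofNat 5 (5 * q % (5 * w.deg)) = 0 := by
      apply Fin.ext
      rw [Nat.mul_mod_mul_left]
      simp
    rw [wrapFun, e, smul_zero, wedgePoint_zero_eq]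
    rfl
  · rfl

/-- Each letter is one full turn from the joint vertex to itself, crossing the closing edge of its
circle exactly once. -/
theorem prefixLabel_mul_five (q : ℕ) (hq : q ≤ w.letters.length) :
    w.prefixLabel (5 * q) =
      ((w.letters.take q).map fun p => FreeGroup.of p.1 ^ p.2).prod := by
  induction q with
  | zero => simp [prefixLabel]
  | succ q ih =>
    have hq' : q < w.letters.length := by omega
    rw [List.take_add_one, List.getElem?_eq_getElem hq', List.map_append, List.prod_append,
      ← ih (by omega)]
    have h0 := w.wedgeCoord_boundaryPoint_mul q
    have h1 := w.wedgeCoord_boundaryPoint hq' (k := 1) (by omega)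
    have h2 := w.wedgeCoord_boundaryPoint hq' (k := 2) (by omega)
    have h3 := w.wedgeCoord_boundaryPoint hq' (k := 3) (by omega)
    have h4 := w.wedgeCoord_boundaryPoint hq' (k := 4) (by omega)
    have h5 := w.wedgeCoord_boundaryPoint_mul (q + 1)
    change w.prefixLabel (5 * q + 4 + 1) = _
    simp only [prefixLabel]
    change wedgeCoord (w.boundaryPoint (5 * q + 4 + 1)) = none at h5
    rw [h0, h1, h2, h3, h4, h5]
    have hs := sign_of_mem_letters (w := w) (List.getElem_mem hq')
    generalize w.letters[q] = p at hs ⊢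
    obtain ⟨s, e⟩ := p
    simp only [Option.toList_some, List.map_cons, List.map_nil, List.prod_cons, List.prod_nil,
      mul_one]
    rcases hs with rfl | rfl
    · simp [circleCoord, wedgeLabel]
    -- A negative letter visits 4, 3, 2, 1, so the closing edge is its first step, taken backwards;
    -- for a positive letter it is the last.
    · have f1 : (-Fin.ofNat 5 1).val = 4 := rfl
      have f2 : (-Fin.ofNat 5 2).val = 3 := rfl
      have f3 : (-Fin.ofNat 5 3).val = 2 := rfl
      have f4 : (-Fin.ofNat 5 4).val = 1 := rfl
      simp only [neg_one_smul, f1, f2, f3, f4]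
      simp [circleCoord, wedgeLabel]

theorem prod_letters : (w.letters.map fun p => FreeGroup.of p.1 ^ p.2).prod = w.eval := by
  induction w with
  | nil => rfl
  | cons p w ih =>
    have e : letters (p :: w) = List.replicate p.2.natAbs (p.1, p.2.sign) ++ letters w := rfl
    rw [e, List.map_append, List.prod_append, ih, List.map_replicate, List.prod_replicate,
      ← zpow_natCast, ← zpow_mul, Int.sign_mul_natAbs]
    rfl

theorem prefixLabel_deg : w.prefixLabel (5 * w.deg) = w.eval := by
  rw [← w.length_letters, w.prefixLabel_mul_five _ le_rfl, List.take_length, w.prod_letters]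

end Word

/-! ### The labelling of the graph of a presentation -/

/-- Coordinates for the vertices of the graph of a presentation; the depth is the distance from the
boundary of the disk. -/
inductive PresentationCoord (m n : ℕ)
  | circle (a : Option (Fin m × ℕ))
  | cell (j : Fin n) (i : ℕ) (depth : ℕ)

section Presentation

variable {m n : ℕ} (r : Fin n → Word m)

open PresentationCoord

/-- The coordinates of a vertex of a disk. -/
def diskCoord (j : Fin n) :
    PushoutVertex (toPoint (cycleGraph (5 * (r j).deg) □ interval 0))
      (coneApexInclusion 3 (cycleGraph (5 * (r j).deg))) → PresentationCoord m n :=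
  -- The apex has no direction; 0 is an arbitrary choice.
  Quot.lift (Sum.elim (fun _ => cell j 0 3) fun p => match p.2 with
    | 0 => cell j 0 3
    | 1 => cell j p.1.val 2
    | 2 => cell j p.1.val 1
    | 3 => circle (wedgeCoord ((r j).wrapFun p.1))) (by
    rintro _ _ ⟨⟨i, u⟩⟩
    rfl)

/-- The coordinates of a vertex of the graph of a presentation. -/
def coord : PresentationVertex r → PresentationCoord m n :=
  Quot.lift (Sum.elim (fun a => circle (wedgeCoord a)) fun p => diskCoord r p.1 p.2) (by
    rintro _ _ ⟨⟨j, i⟩⟩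
    rfl)

/-- A relation in coordinates which contains equality and adjacency. -/
def CoordNear : PresentationCoord m n → PresentationCoord m n → Prop
  | circle a, circle b => WedgeNear a b
  | circle a, cell j i e => e = 1 ∧ a = wedgeCoord ((r j).boundaryPoint i)
  | cell j i e, circle a => e = 1 ∧ a = wedgeCoord ((r j).boundaryPoint i)
  -- Directions are compared only if one of the vertices has depth 1. The apex, recorded with
  -- direction 0, is adjacent to depth 2 in every direction, but never to depth 1.
  | cell j i e, cell j' i' e' => j = j' ∧ (e = 1 ∨ e' = 1 → i = i' ∨
      CycleSucc (5 * (r j).deg) i i' ∨ CycleSucc (5 * (r j).deg) i' i)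

theorem CoordNear.refl (a : PresentationCoord m n) : CoordNear r a a := by
  rcases a with a | ⟨j, i, e⟩
  · exact WedgeNear.refl a
  · exact ⟨rfl, fun _ => Or.inl rfl⟩

variable {r} in
theorem CoordNear.symm {a b : PresentationCoord m n} (h : CoordNear r a b) :
    CoordNear r b a := by
  rcases a with a | ⟨j, i, e⟩ <;> rcases b with b | ⟨j', i', e'⟩
  · exact WedgeNear.symm h
  · exact h
  · exact h
  · obtain ⟨rfl, h⟩ := h
    exact ⟨rfl, fun ho => (h ho.symm).imp Eq.symm Or.symm⟩

theorem CoordNear.of_edge {a b : PresentationVertex r} (h : PresentationEdge r a b) :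
    CoordNear r (coord r a) (coord r b) := by
  induction h with
  | wedge s k => exact wedgeNear_circleCoord s k
  | outer j i => exact ⟨rfl, by rw [Word.boundaryPoint_val]⟩
  | middle j i => exact ⟨rfl, fun _ => Or.inl rfl⟩
  | inner j i => exact ⟨rfl, by omega⟩
  | ring j i i' l hl h =>
    rcases hl with rfl | rfl
    · exact ⟨rfl, fun _ => Or.inr (Or.inl h)⟩
    · exact ⟨rfl, fun _ => Or.inr (Or.inl h)⟩

theorem CoordNear.of_near {a b : PresentationVertex r} (h : Near (presentationGraph r) a b) :
    CoordNear r (coord r a) (coord r b) := by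
  rcases near_cases h with rfl | h | h
  · exact CoordNear.refl r _
  · exact CoordNear.of_edge r h
  · exact (CoordNear.of_edge r h).symm

/-- The group of a presentation. -/
abbrev RelatorGroup := PresentedGroup (Set.range fun j => (r j).eval)

/-- The label of an edge of the graph of a presentation: the edges inside of the disks have label
one, and the edges between a disk and the wedge of circles have the label which makes the label
around each square one. -/
def coordLabel : PresentationCoord m n → PresentationCoord m n → RelatorGroup r
  | circle a, circle b => PresentedGroup.mk _ (wedgeLabel a b)
  | circle _, cell j i _ => (PresentedGroup.mk _ ((r j).prefixLabel i))⁻¹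
  | cell j i _, circle _ => PresentedGroup.mk _ ((r j).prefixLabel i)
  | cell _ _ _, cell _ _ _ => 1

/-- The only place where the relators are used: the last step around the boundary returns to time 0,
and the full prefix is the relator, which is 1 in the group. -/
theorem mk_prefixLabel_of_cycleSucc {j : Fin n} {i i' : ℕ}
    (h : CycleSucc (5 * (r j).deg) i i') :
    (PresentedGroup.mk _ ((r j).prefixLabel i') : RelatorGroup r) =
      PresentedGroup.mk _ ((r j).prefixLabel i) * PresentedGroup.mk _
        (wedgeLabel (wedgeCoord ((r j).boundaryPoint i))
          (wedgeCoord ((r j).boundaryPoint i'))) := by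
  rcases h with ⟨rfl, -⟩ | ⟨rfl, h⟩
  · rw [← map_mul]; rfl
  · rw [← (r j).boundaryPoint_deg, ← h, ← map_mul]
    change PresentedGroup.mk _ 1 = PresentedGroup.mk _ ((r j).prefixLabel (i + 1))
    rw [h, Word.prefixLabel_deg, map_one]
    have hj : (r j).eval ∈ Set.range fun j => (r j).eval := ⟨j, rfl⟩
    exact (PresentedGroup.one_of_mem hj).symm

theorem mk_prefixLabel_of_near {j : Fin n} {i i' : ℕ}
    (h : i = i' ∨ CycleSucc (5 * (r j).deg) i i' ∨ CycleSucc (5 * (r j).deg) i' i) :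
    (PresentedGroup.mk _ ((r j).prefixLabel i') : RelatorGroup r) =
      PresentedGroup.mk _ ((r j).prefixLabel i) * PresentedGroup.mk _
        (wedgeLabel (wedgeCoord ((r j).boundaryPoint i))
          (wedgeCoord ((r j).boundaryPoint i'))) := by
  rcases h with rfl | h | h
  · rw [wedgeLabel_self, map_one, mul_one]
  · exact mk_prefixLabel_of_cycleSucc r h
  · rw [mk_prefixLabel_of_cycleSucc r h, mul_assoc, ← map_mul, wedgeLabel_mul_swap, map_one,
      mul_one]

/-- Times i and i' need not be neighbours, as when the word backtracks. Both prefixes, followed by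
the same wedge label, give the prefix at time l. -/
theorem mk_prefixLabel_eq {j j' k : Fin n} {i i' l : ℕ} {d : ℕ}
    (h : CoordNear r (cell j i 1) (cell k l d))
    (h' : CoordNear r (cell j' i' 1) (cell k l d))
    (e : wedgeCoord ((r j).boundaryPoint i) = wedgeCoord ((r j').boundaryPoint i')) :
    (PresentedGroup.mk _ ((r j).prefixLabel i) : RelatorGroup r) =
      PresentedGroup.mk _ ((r j').prefixLabel i') := by
  obtain ⟨rfl, h⟩ := h
  obtain ⟨rfl, h'⟩ := h'
  have h1 := mk_prefixLabel_of_near r (h (Or.inl rfl))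
  have h2 := mk_prefixLabel_of_near r (h' (Or.inl rfl))
  rw [e, h2] at h1
  exact (mul_right_cancel h1).symm

/-- The cases depend on the corners in the wedge. For four, this is `wedgeLabel_square`. For three,
the corner in the disk meets the wedge at a single coordinate, so its two neighbours coincide. For
two adjacent ones, `side` compares consecutive prefixes; for two opposite ones, the labels cancel or
the sides agree at once. For one, `mk_prefixLabel_eq` applies. For none, all labels are 1. -/
theorem coordLabel_square {a b c d : PresentationCoord m n} (hab : CoordNear r a b)
    (hbd : CoordNear r b d) (hac : CoordNear r a c) (hcd : CoordNear r c d) :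
    coordLabel r a b * coordLabel r b d = coordLabel r a c * coordLabel r c d := by
  have side : ∀ {j j' : Fin n} {i i' : ℕ} {a b},
      CoordNear r (cell j i 1) (cell j' i' 1) →
      a = wedgeCoord ((r j).boundaryPoint i) → b = wedgeCoord ((r j').boundaryPoint i') →
      (PresentedGroup.mk _ ((r j').prefixLabel i') : RelatorGroup r) =
        PresentedGroup.mk _ ((r j).prefixLabel i) * PresentedGroup.mk _ (wedgeLabel a b) := by
    rintro j _ i i' _ _ ⟨rfl, h⟩ rfl rfl
    exact mk_prefixLabel_of_near r (h (Or.inl rfl))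
  have swap : ∀ a b, (PresentedGroup.mk _ (wedgeLabel a b) : RelatorGroup r) *
      PresentedGroup.mk _ (wedgeLabel b a) = 1 := fun a b => by
    rw [← map_mul, wedgeLabel_mul_swap, map_one]
  have pr : ∀ {a j i e}, CoordNear r (circle a) (cell j i e) →
      e = 1 ∧ a = wedgeCoord ((r j).boundaryPoint i) := fun h => h
  rcases a with a | ⟨ja, ia, ea⟩ <;> rcases b with b | ⟨jb, ib, eb⟩ <;>
    rcases c with c | ⟨jc, ic, ec⟩ <;> rcases d with d | ⟨jd, id, ed⟩ <;>
    simp only [coordLabel, mul_one, one_mul]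
  · rw [← map_mul, ← map_mul, wedgeLabel_square hab hbd hac hcd]
  · obtain ⟨-, rfl⟩ := pr hbd
    obtain ⟨-, rfl⟩ := pr hcd
    rfl
  · obtain ⟨-, rfl⟩ := pr hac
    obtain ⟨-, rfl⟩ := pr hcd.symm
    rw [swap, inv_mul_cancel]
  · obtain ⟨rfl, ha⟩ := pr hac
    obtain ⟨rfl, hb⟩ := pr hbd
    rw [side hcd ha hb, mul_inv_rev, mul_inv_cancel_left]
  · obtain ⟨-, rfl⟩ := pr hab
    obtain ⟨-, rfl⟩ := pr hbd.symm
    rw [swap, inv_mul_cancel]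
  · obtain ⟨rfl, ha⟩ := pr hab
    obtain ⟨rfl, hc⟩ := pr hcd
    rw [side hbd ha hc, mul_inv_rev, mul_inv_cancel_left]
  · rw [inv_mul_cancel, inv_mul_cancel]
  · obtain ⟨rfl, ha⟩ := pr hab
    obtain ⟨rfl, ha'⟩ := pr hac
    rw [mk_prefixLabel_eq r hbd hcd (ha.symm.trans ha')]
  · obtain ⟨-, rfl⟩ := pr hab.symm
    obtain ⟨-, rfl⟩ := pr hac.symm
    rfl
  · obtain ⟨rfl, hb⟩ := pr hab.symm
    obtain ⟨rfl, hd⟩ := pr hcd.symm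
    rw [side hac hb hd]
  · obtain ⟨rfl, hb⟩ := pr hab.symm
    obtain ⟨rfl, hb'⟩ := pr hbd
    rw [mk_prefixLabel_eq r hac hcd.symm (hb.symm.trans hb'), mul_inv_cancel]
  · obtain ⟨rfl, hc⟩ := pr hac.symm
    obtain ⟨rfl, hd⟩ := pr hbd.symm
    rw [side hab hc hd]
  · obtain ⟨rfl, hc⟩ := pr hac.symm
    obtain ⟨rfl, hc'⟩ := pr hcd
    rw [mk_prefixLabel_eq r hab hbd.symm (hc.symm.trans hc'), mul_inv_cancel]
  · obtain ⟨rfl, hd⟩ := pr hbd.symm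
    obtain ⟨rfl, hd'⟩ := pr hcd.symm
    exact mk_prefixLabel_eq r hab.symm hac.symm (hd.symm.trans hd')

/-- The labelling of the graph of a presentation by the elements of its group. -/
def presentationLabelling : Labelling (presentationGraph r) (RelatorGroup r) where
  label a b := coordLabel r (coord r a) (coord r b)
  self a := by
    rcases coord r a with a | ⟨j, i, e⟩
    · change PresentedGroup.mk _ (wedgeLabel a a) = 1
      rw [wedgeLabel_self, map_one]
    · rfl
  square h1 h2 h3 h4 := coordLabel_square r (CoordNear.of_near r h1) (CoordNear.of_near r h2)
    (CoordNear.of_near r h3) (CoordNear.of_near r h4)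

end Presentation

/-! ### Labellings of the graph of a presentation up to a change of gauge -/

section Gauge

variable {m n : ℕ} {r : Fin n → Word m} {H : Type*} [Group H]
  (L : Labelling (presentationGraph r) H)

open PresentationCoord

/-- The product of the labels along the first `k` edges of the circle with index `s`. -/
def circleProd (s : Fin m) : ℕ → H
  | 0 => 1
  | k + 1 => circleProd s k * L.label ((ofWedge r).toFun (wedgePoint s (Fin.ofNat 5 k)))
      ((ofWedge r).toFun (wedgePoint s (Fin.ofNat 5 (k + 1))))

/-- The homomorphism which sends a generator to the product of the labels around its circle. -/
def freeHolonomy : FreeGroup (Fin m) →* H := FreeGroup.lift fun s => circleProd L s 5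

/-- The change of gauge on the wedge of circles. -/
def wedgeGauge : Option (Fin m × ℕ) → H
  | none => 1
  | some (s, k) => circleProd L s k

theorem wedgeGauge_circleCoord (s : Fin m) (k : ℕ) :
    wedgeGauge L (circleCoord s k) = circleProd L s k := by
  unfold circleCoord
  split_ifs with h
  · rw [h]; rfl
  · rfl

/-- The gauge identity of an edge passes to the reversed edge, so one orientation of each edge is
enough. -/
theorem mul_eq_mul_swap {x l p y l' p' : H} (h : x * l = p * y) (hl : l * l' = 1)
    (hp : p * p' = 1) : y * l' = p' * x := by
  rw [← inv_eq_of_mul_eq_one_right hl, ← inv_eq_of_mul_eq_one_right hp, mul_inv_eq_iff_eq_mul,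
    mul_assoc, h, inv_mul_cancel_left]

/-- In this gauge the labels along a circle become 1 up to the closing edge, which collects the
product around the circle, that is, the value of `freeHolonomy` at the generator. -/
theorem wedgeGauge_mul_label {a b : WedgeVertex m} (h : Near (wedge m) a b) :
    wedgeGauge L (wedgeCoord a) * L.label ((ofWedge r).toFun a) ((ofWedge r).toFun b) =
      freeHolonomy L (wedgeLabel (wedgeCoord a) (wedgeCoord b)) *
        wedgeGauge L (wedgeCoord b) := by
  have key : ∀ s (k : Fin 5),
      wedgeGauge L (wedgeCoord (wedgePoint s k)) *
        L.label ((ofWedge r).toFun (wedgePoint s k)) ((ofWedge r).toFun (wedgePoint s (k + 1))) =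
      freeHolonomy L (wedgeLabel (wedgeCoord (wedgePoint s k))
        (wedgeCoord (wedgePoint s (k + 1)))) * wedgeGauge L (wedgeCoord (wedgePoint s (k + 1))) := by
    intro s k
    rw [wedgeCoord_wedgePoint, wedgeCoord_wedgePoint, wedgeGauge_circleCoord,
      wedgeGauge_circleCoord]
    have e0 : Fin.ofNat 5 k.val = k := Fin.ext (Nat.mod_eq_of_lt k.isLt)
    have e1 : Fin.ofNat 5 (k.val + 1) = k + 1 := Fin.ext (by simp [Fin.val_add])
    have h1 : circleProd L s k.val * L.label ((ofWedge r).toFun (wedgePoint s k))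
        ((ofWedge r).toFun (wedgePoint s (k + 1))) = circleProd L s (k.val + 1) := by
      rw [circleProd, e0, e1]
    rw [h1]
    have h5 : circleProd L s 5 = freeHolonomy L (FreeGroup.of s) * circleProd L s 0 := by
      rw [circleProd.eq_1, mul_one, freeHolonomy, FreeGroup.lift_apply_of]
    match k with
    | 0 | 1 | 2 | 3 => exact (one_mul _).symm.trans (congrArg (· * _) (map_one _).symm)
    | 4 => exact h5
  rcases h with rfl | h
  · rw [L.self, wedgeLabel_self, map_one, mul_one, one_mul]
  · obtain ⟨s, k, l, hkl, rfl, rfl⟩ := wedge_adj_cases h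
    rw [SimpleGraph.cycleGraph_adj] at hkl
    rcases hkl with h | h
    · obtain rfl : k = l + 1 := by rw [← h]; abel
      refine mul_eq_mul_swap (key s l) (L.mul_swap (PresentationEdge.wedge s l).near) ?_
      rw [← map_mul, wedgeLabel_mul_swap, map_one]
    · obtain rfl : l = k + 1 := by rw [← h]; abel
      exact key s k

theorem cycleSucc_mod {k : ℕ} (hk : 0 < k) (t : ℕ) : CycleSucc k (t % k) ((t + 1) % k) := by
  have h := Nat.mod_lt t hk
  unfold CycleSucc
  rw [Nat.add_mod_eq_ite]
  by_cases h1 : k = 1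
  · subst h1; simp [Nat.mod_one]
  · rw [Nat.mod_eq_of_lt (show 1 < k by omega)]
    split_ifs <;> omega

theorem Word.boundaryPoint_near (w : Word m) (t : ℕ) :
    Near (wedge m) (w.boundaryPoint t) (w.boundaryPoint (t + 1)) := by
  unfold Word.boundaryPoint
  split_ifs with h
  · rcases cycleSucc_mod h t with h | h
    · exact wrapFun_step w _ _ (Or.inl h.1)
    · exact wrapFun_step w _ _ (Or.inr h)
  · exact Near.rfl

/-! ### Extension of the gauge over the disks -/

variable {j : Fin n} (hj : 0 < 5 * (r j).deg)

/-- The vertex of a disk in the direction `t` and at the depth `d`. -/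
def diskVertex (d t : ℕ) : PresentationVertex r :=
  ofDisk r j ⟨t % (5 * (r j).deg), Nat.mod_lt _ hj⟩ ⟨3 - d, by omega⟩

theorem diskVertex_zero (t : ℕ) :
    diskVertex hj 0 t = (ofWedge r).toFun ((r j).boundaryPoint t) := by
  rw [Word.boundaryPoint, dif_pos hj]
  exact ofDisk_three r j _

theorem diskVertex_val (d : ℕ) (i : Fin (5 * (r j).deg)) :
    diskVertex hj d i.val = ofDisk r j i ⟨3 - d, by omega⟩ := by
  unfold diskVertex
  congr 1
  exact Fin.ext (Nat.mod_eq_of_lt i.isLt)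

theorem diskVertex_deg (d : ℕ) : diskVertex hj d (5 * (r j).deg) = diskVertex hj d 0 := by
  simp [diskVertex]

theorem diskVertex_near_succ (d t : ℕ) :
    Near (presentationGraph r) (diskVertex hj d t) (diskVertex hj d (t + 1)) := by
  unfold diskVertex
  rcases adj_of_cycleSucc (i := ⟨t % (5 * (r j).deg), Nat.mod_lt _ hj⟩)
    (j := ⟨(t + 1) % (5 * (r j).deg), Nat.mod_lt _ hj⟩) (cycleSucc_mod hj t) with e | e
  · rw [e]; exact Near.rfl
  · exact ofDisk_adj (Or.inl ⟨e, rfl⟩)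

theorem diskVertex_near_depth (d t : ℕ) :
    Near (presentationGraph r) (diskVertex hj d t) (diskVertex hj (d + 1) t) := by
  unfold diskVertex
  rcases lt_or_ge d 3 with h | h
  · exact ofDisk_adj (Or.inr ⟨rfl, Or.inr (by simp only; omega)⟩)
  -- Truncated subtraction: beyond depth 3 the vertex stays at the apex.
  · left
    congr 2
    omega

/-- The change of gauge on a disk. -/
def diskGauge : ℕ → ℕ → H
  | 0, t => freeHolonomy L ((r j).prefixLabel t) *
      wedgeGauge L (wedgeCoord ((r j).boundaryPoint t))
  | d + 1, t => diskGauge d t * L.label (diskVertex hj d t) (diskVertex hj (d + 1) t)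

/-- Parallel transport along the boundary is pushed inwards, one layer of squares at a time. -/
theorem diskGauge_mul_label_succ (d t : ℕ) :
    diskGauge L hj d t * L.label (diskVertex hj d t) (diskVertex hj d (t + 1)) =
      diskGauge L hj d (t + 1) := by
  induction d with
  | zero =>
    rw [diskGauge, diskGauge, diskVertex_zero, diskVertex_zero, mul_assoc,
      wedgeGauge_mul_label L ((r j).boundaryPoint_near t), ← mul_assoc, ← map_mul]
    rfl
  | succ d ih =>
    rw [diskGauge, diskGauge, ← ih, mul_assoc, mul_assoc,
      L.square (diskVertex_near_depth hj d t) (diskVertex_near_succ hj (d + 1) t)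
        (diskVertex_near_succ hj d t) (diskVertex_near_depth hj d (t + 1))]

/-- One turn multiplies the boundary values on the left by the holonomy of the relator; transport
along the spokes multiplies on the right and keeps this factor. -/
theorem diskGauge_deg (d : ℕ) :
    diskGauge L hj d (5 * (r j).deg) = freeHolonomy L (r j).eval * diskGauge L hj d 0 := by
  induction d with
  | zero =>
    rw [diskGauge, diskGauge, Word.prefixLabel_deg, Word.boundaryPoint_deg, Word.prefixLabel,
      map_one, one_mul]
  | succ d ih => rw [diskGauge, diskGauge, ih, diskVertex_deg, diskVertex_deg, mul_assoc]

/-- At depth 3 all directions give the same vertex, so moving around costs the label 1. -/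
theorem diskGauge_apex (t : ℕ) : diskGauge L hj 3 t = diskGauge L hj 3 0 := by
  induction t with
  | zero => rfl
  | succ t ih =>
    have e : diskVertex hj 3 t = diskVertex hj 3 (t + 1) := ofDisk_zero r j _ _
    rw [← ih, ← diskGauge_mul_label_succ, e, L.self, mul_one]

/-- The change of gauge on the graph of a presentation. -/
def presentationGauge (hr : ∀ j, 0 < 5 * (r j).deg) : PresentationCoord m n → H
  | circle a => wedgeGauge L a
  | cell j i d => diskGauge L (hr j) d i

theorem diskGauge_of_cycleSucc {i i' : ℕ} (d : ℕ)
    (h : CycleSucc (5 * (r j).deg) i i') (he : freeHolonomy L (r j).eval = 1) :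
    diskGauge L hj d i * L.label (diskVertex hj d i) (diskVertex hj d i') =
      diskGauge L hj d i' := by
  rcases h with ⟨rfl, -⟩ | ⟨rfl, h⟩
  · exact diskGauge_mul_label_succ L hj d i
  · have e := diskGauge_deg L hj d
    rw [he, one_mul, ← h] at e
    rw [← e, ← diskGauge_mul_label_succ, h, diskVertex_deg]

/-- At the apex one turn changes the gauge by the holonomy of the relator, yet the gauge there does
not depend on the direction. -/
theorem freeHolonomy_eval (hr : ∀ j, 0 < 5 * (r j).deg) (j : Fin n) :
    freeHolonomy L (r j).eval = 1 := by
  have h := diskGauge_deg L (hr j) 3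
  rw [diskGauge_apex] at h
  exact right_eq_mul.mp h

variable (hr : ∀ j, 0 < 5 * (r j).deg)

/-- The homomorphism from the group of a presentation which sends a generator to the product of
the labels around its circle. -/
def relatorHolonomy : RelatorGroup r →* H :=
  PresentedGroup.toGroup (f := fun s => circleProd L s 5) (by
    rintro _ ⟨j, rfl⟩
    exact freeHolonomy_eval L hr j)

theorem presentationGauge_mul_label {a b : PresentationVertex r}
    (h : Near (presentationGraph r) a b) :
    presentationGauge L hr (coord r a) * L.label a b =
      relatorHolonomy L hr ((presentationLabelling r).label a b) *
        presentationGauge L hr (coord r b) := by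
  have key : ∀ a b, PresentationEdge r a b →
      presentationGauge L hr (coord r a) * L.label a b =
        relatorHolonomy L hr ((presentationLabelling r).label a b) *
          presentationGauge L hr (coord r b) := by
    intro a b h
    induction h with
    | wedge s k =>
      have h1 : (cycleGraph 5).Adj k (k + 1) := by
        rw [SimpleGraph.cycleGraph_adj]; right; simp
      exact wedgeGauge_mul_label L (wedgePoint_adj s h1)
    | outer j i =>
      change diskGauge L (hr j) 1 i.val * _ =
        freeHolonomy L ((r j).prefixLabel i.val) * wedgeGauge L (wedgeCoord ((r j).wrapFun i))
      rw [← Word.boundaryPoint_val, ← diskVertex_zero (hr j)]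
      have e : ofDisk r j i 2 = diskVertex (hr j) 1 i.val := (diskVertex_val (hr j) 1 i).symm
      -- The gauge at depth 1 was transported along this same edge from the boundary, so the two
      -- labels cancel.
      rw [e, diskGauge, mul_assoc, L.mul_swap (diskVertex_near_depth (hr j) 0 i.val), mul_one]
      rfl
    | middle j i =>
      change diskGauge L (hr j) 1 i.val * _ =
        relatorHolonomy L hr 1 * diskGauge L (hr j) 2 i.val
      have e1 : ofDisk r j i 2 = diskVertex (hr j) 1 i.val := (diskVertex_val (hr j) 1 i).symm
      have e2 : ofDisk r j i 1 = diskVertex (hr j) 2 i.val := (diskVertex_val (hr j) 2 i).symm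
      rw [e1, e2, map_one, one_mul]
      rfl
    | inner j i =>
      change diskGauge L (hr j) 2 i.val * _ =
        relatorHolonomy L hr 1 * diskGauge L (hr j) 3 0
      have e2 : ofDisk r j i 1 = diskVertex (hr j) 2 i.val := (diskVertex_val (hr j) 2 i).symm
      have e3 : ofDisk r j i 0 = diskVertex (hr j) 3 i.val := (diskVertex_val (hr j) 3 i).symm
      -- The coordinate of the apex has direction 0, and the spoke has direction i.
      rw [e2, e3, map_one, one_mul, ← diskGauge_apex L (hr j) i.val]
      rfl
    | ring j i i' l hl h =>
      have he := freeHolonomy_eval L hr j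
      rcases hl with rfl | rfl
      · have h2 := diskGauge_of_cycleSucc L (hr j) 2 h he
        rw [diskVertex_val, diskVertex_val] at h2
        exact h2.trans ((one_mul _).symm.trans (congrArg (· * _) (map_one _).symm))
      · have h2 := diskGauge_of_cycleSucc L (hr j) 1 h he
        rw [diskVertex_val, diskVertex_val] at h2
        exact h2.trans ((one_mul _).symm.trans (congrArg (· * _) (map_one _).symm))
  rcases near_cases h with rfl | h | h
  · rw [L.self, Labelling.self, map_one, mul_one, one_mul]
  · exact key a b h
  · refine mul_eq_mul_swap (key b a h) (L.mul_swap h.near) ?_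
    rw [← map_mul, Labelling.mul_swap _ h.near, map_one]

end Gauge

/-! ### The fundamental group -/

section Main

variable {m n : ℕ} (r : Fin n → Word m)

/-- The loop around the circle with index `s`. -/
def circleLoop (s : Fin m) : InfPath (presentationGraph r) ((ofWedge r).toFun (wedgeBase m))
    ((ofWedge r).toFun (wedgeBase m)) :=
  InfPath.ofStep (fun i => (ofWedge r).toFun (wedgePoint s (Fin.ofNat 5 (min i.toNat 5))))
    (fun i => by
      by_cases h : 0 ≤ i ∧ i < 5
      · have e : Fin.ofNat 5 (min (i + 1).toNat 5) = Fin.ofNat 5 (min i.toNat 5) + 1 := by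
          rw [show min (i + 1).toNat 5 = min i.toNat 5 + 1 by omega]
          exact Fin.ext (by simp [Fin.val_add])
        rw [e]
        exact (PresentationEdge.wedge s _).near
      · left
        rcases lt_or_ge i 0 with hi | hi
        · rw [show min (i + 1).toNat 5 = min i.toNat 5 by omega]
        · rw [show min (i + 1).toNat 5 = min i.toNat 5 by omega])
    ⟨0, fun i hi => by
      rw [show min i.toNat 5 = 0 by omega, show Fin.ofNat 5 0 = 0 from rfl, wedgePoint_zero_eq]⟩
    ⟨5, fun i hi => by
      rw [show min i.toNat 5 = 5 by omega, show Fin.ofNat 5 5 = 0 from rfl, wedgePoint_zero_eq]⟩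

/-- Only the step from time 4 to time 5, along the closing edge, has a label other than 1 in the
definition of the labelling. -/
theorem hol_circleLoop (s : Fin m) :
    (presentationLabelling r).hol (circleLoop r s) = PresentedGroup.of s := by
  refine Labelling.IsDevelopment.hol_eq (h := fun i => if i ≤ 4 then 1 else PresentedGroup.of s)
    ⟨⟨4, fun i hi => if_pos hi⟩, fun i => ?_, ⟨5, fun i hi => if_neg (by omega)⟩⟩
  by_cases h : 0 ≤ i ∧ i < 5
  · obtain ⟨h0, h5⟩ := h
    interval_cases i
    · exact (mul_one _).symm
    · exact (mul_one _).symm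
    · exact (mul_one _).symm
    · exact (mul_one _).symm
    · exact (one_mul _).symm
  · have e : (circleLoop r s).toFun (i + 1) = (circleLoop r s).toFun i := by
      simp only [circleLoop, InfPath.ofStep]
      rw [show min (i + 1).toNat 5 = min i.toNat 5 by omega]
    rw [e, Labelling.self, mul_one]
    split_ifs <;> first | rfl | omega

theorem holHom_presentationLabelling_bijective (hr : ∀ j, 0 < (r j).deg)
    (x : PresentationVertex r) :
    Function.Bijective ((presentationLabelling r).holHom x) := by
  have hX := presentationGraph_preconnected hr
  have hr' : ∀ j, 0 < 5 * (r j).deg := fun j => Nat.mul_pos (by norm_num) (hr j)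
  refine ⟨Labelling.holHom_injective _ hX x fun L =>
    ⟨relatorHolonomy L hr', fun v => presentationGauge L hr' (coord r v),
      fun a b h => presentationGauge_mul_label L hr' h⟩,
    Labelling.holHom_surjective _ hX (y := (ofWedge r).toFun (wedgeBase m)) ?_⟩
  -- At the joint vertex the image is a subgroup containing the generators, by the loops around the
  -- circles.
  rw [← MonoidHom.range_eq_top, eq_top_iff, ← PresentedGroup.closure_range_of,
    Subgroup.closure_le]
  rintro _ ⟨s, rfl⟩
  exact ⟨A₁.mk (circleLoop r s), hol_circleLoop r s⟩

end Main

end DiscreteHomotopy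

/-- If `G` is presented by `⟨s_1, …, s_m | r_1, …, r_n⟩`, each relator being a term of positive
degree, then the fundamental group of the graph of the presentation, at any vertex, is
isomorphic to `G`. -/
theorem mainTheorem9 {G : Type*} [Group G] (m n : ℕ) (r : Fin n → DiscreteHomotopy.Word m)
    (hr : ∀ j, 0 < (r j).deg)
    (hG : Nonempty (PresentedGroup (Set.range fun j => (r j).eval) ≃* G))
    (x : DiscreteHomotopy.PresentationVertex r) :
    Nonempty (DiscreteHomotopy.A₁ (DiscreteHomotopy.presentationGraph r) x ≃* G) :=
  hG.map fun e => (MulEquiv.ofBijective _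
    (DiscreteHomotopy.holHom_presentationLabelling_bijective r hr x)).trans e
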